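/- Let $B=(V,E,\preceq)$ be a properly ordered Bratteli diagram: $V_0=\{v_0\}$, the sets $V_n$, $E_n$ are finite, the edges of $E_n$ join $V_{n-1}$ to $V_n$ $(n\ge 1)$, every vertex of level $\ge 1$ is the end-point of an edge, every vertex is the initial vertex of an edge, two edges are comparable exactly when they have the same end-point, and there are exactly one infinite path with only maximal edges and exactly one with only minimal edges. Let $X$ be its space of infinite paths from $v_0$ and $T:X\to X$ the Vershik map. Suppose that: - *(proper of rank $d$)* there is exactly one edge from $v_0$ to each vertex of $V_1$; for $n\ge 2$ every vertex of $V_{n-1}$ is joined to every vertex of $V_n$ and all maximal edges of $E_n$ start in the same vertex; and $V_n$ is identified with $\{1,\dots,d\}$ for all $n\ge 1$; - *(Toeplitz type)* for all $n\ge 1$ exactly $q_n$ edges of $E_n$ end at each vertex of $V_n$; put $p_n=q_1q_2\cdots q_n$; - *(clean)* with $\tau_n(x)\in V_n$ the vertex of level $n$ on the path $x$, there are $\delta>0$ and, for every $T$-invariant ergodic Borel probability measure $\mu$, a set $I_\mu\subseteq\{1,\dots,d\}$ such that $\mu(\tau_n=t)\ge\delta$ for all $t\in I_\mu$ and $n\ge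 1$, $\lim_{n\to\infty}\mu(\tau_n=t)=0$ for all $t\notin I_\mu$, and $I_\mu\cap I_{\nu}=\emptyset$ for different ergodic measures $\mu,\nu$. For $m<n$ let $\bar s_{m,n}(x)$ be the number of paths from level $m$ to level $n$ which end at $\tau_n(x)$ and are strictly bigger than the part of $x$ between these levels, for the induced order (compare the last edges that differ). Let $\mu$ be an ergodic probability measure, and let $a,b$ be coprime integers, $b\ge 1$. Then $\lambda=\exp(2i\pi a/b)$ is a non continuous eigenvalue of $(X,T)$ for $\mu$ (there is a non zero $f\in L^2(X,\mu)$ with $f\circ T=\lambda f$ $\mu$-a.e., but no non zero continuous $f:X\to\mathbb C$ with $f\circ T=\lambda f$) if and only if there is a telescoping of the diagram, given by integers $0=n_0<n_1<n_2<\cdots$, for which, with $p'_j=p_{n_j}$, $\tau'_j=\tau_{n_j}$ and $\bar s'_j=\bar s_{n_j,n_{j+1}}$ (the corresponding objects of the telescoped diagram), there are $p\in\{0,\dots,b-1\}$, an integer $\mathbf b$ and a map $k:\{1,\dots,d\}^2\to\{0,\dots,\mathbf b-1\}$ such that: 1. $p'_j\equiv p \pmod b$ for all $j\ge 2$; 2.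 $1<\mathbf b\le d$ and $b/(b,p'_j)=\mathbf b$ for all large enough $j$; 3. for all $t_1,t_2,t_3\in I_\mu$: $p\,k(t_1,t_3)\equiv p\,k(t_1,t_2)+p\,k(t_2,t_3)$, $p\,k(t_1,t_1)\equiv 0$ and $p\,k(t_1,t_2)\equiv -p\,k(t_2,t_1) \pmod b$; 4. for $\mu$-almost every $x\in X$, for all large enough $j$: $\tau'_j(x)\in I_\mu$ and $\bar s'_j(x)\equiv k(\tau'_j(x),\tau'_{j+1}(x)) \pmod{\mathbf b}$. -/

import Mathlib

open MeasureTheory Filter Topology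

/-- An ordered Bratteli diagram. `V n` is the set of vertices of level `n`, and `E n` is the set of
edges between level `n` and level `n + 1` (so `E n` is the usual `E_{n+1}`). Two edges of the same
level are comparable if and only if they have the same end-point. -/
structure OrderedBratteliDiagram where
  V : ℕ → Type
  E : ℕ → Type
  finV : ∀ n, Finite (V n)
  finE : ∀ n, Finite (E n)
  /-- initial vertex of an edge -/
  src : ∀ {n : ℕ}, E n → V n
  /-- end-point of an edge -/
  tgt : ∀ {n : ℕ}, E n → V (n + 1)
  edgeOrder : ∀ n, PartialOrder (E n)
  root_unique : ∃ v : V 0, ∀ w : V 0, w = v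
  exists_tgt : ∀ {n : ℕ} (v : V (n + 1)), ∃ e : E n, tgt e = v
  exists_src : ∀ {n : ℕ} (v : V n), ∃ e : E n, src e = v
  comparable_iff : ∀ {n : ℕ} (e f : E n), (e ≤ f ∨ f ≤ e) ↔ tgt e = tgt f

namespace OrderedBratteliDiagram

attribute [instance] OrderedBratteliDiagram.finV OrderedBratteliDiagram.finE
  OrderedBratteliDiagram.edgeOrder

/-- The path space `X_B`: infinite paths starting at the root. -/
def X (B : OrderedBratteliDiagram) : Type :=
  {x : ∀ n, B.E n // ∀ n, B.tgt (x n) = B.src (x (n + 1))}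

/-- The topology of the path space is generated by the cylinder sets, that is, it is induced by the
product of the discrete topologies on the edge sets. -/
instance (B : OrderedBratteliDiagram) : TopologicalSpace B.X :=
  TopologicalSpace.induced (fun x : B.X => x.1)
    (@Pi.topologicalSpace ℕ B.E (fun _ => ⊥))

instance (B : OrderedBratteliDiagram) : MeasurableSpace B.X := borel B.X

instance (B : OrderedBratteliDiagram) : BorelSpace B.X := ⟨rfl⟩

/-- Properly ordered: there is exactly one infinite path all of whose edges are maximal and exactly
one infinite path all of whose edges are minimal. -/
def ProperlyOrdered (B : OrderedBratteliDiagram) : Prop :=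
  (∃! x : B.X, ∀ n, IsMax (x.1 n)) ∧ (∃! x : B.X, ∀ n, IsMin (x.1 n))

/-- `B.VershikRel x y` says that `y` is the image of `x` under the Vershik map: either `x` is
maximal and `y` is minimal, or, `n` being the first index at which `x` is not maximal, `y n` is the
successor of `x n` in the local order, `y` is minimal before `n`, and `y` agrees with `x` after
`n`. -/
def VershikRel (B : OrderedBratteliDiagram) (x y : B.X) : Prop :=
  ((∀ n, IsMax (x.1 n)) ∧ ∀ n, IsMin (y.1 n)) ∨
    ∃ n, (∀ i < n, IsMax (x.1 i)) ∧ x.1 n ⋖ y.1 n ∧ (∀ i < n, IsMin (y.1 i)) ∧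
      ∀ i, n < i → y.1 i = x.1 i

open Classical in
/-- The Vershik map `V_B` on the path space. By `existsUnique_vershikRel` below, for a properly
ordered diagram each `x` has exactly one image, and the default branch is never used. -/
noncomputable def vershik (B : OrderedBratteliDiagram) (x : B.X) : B.X :=
  if h : ∃ y, B.VershikRel x y then h.choose else x

theorem exists_min_edge (B : OrderedBratteliDiagram) {n : ℕ} (v : B.V (n + 1)) :
    ∃ e : B.E n, B.tgt e = v ∧ IsMin e := by
  obtain ⟨e, he⟩ := B.exists_tgt v
  obtain ⟨f, hfe, hf⟩ := (Set.toFinite (Set.univ : Set (B.E n))).exists_le_minimal (Set.mem_univ e)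
  refine ⟨f, ?_, fun g hg => hf.2 (Set.mem_univ g) hg⟩
  rw [← he]
  exact (B.comparable_iff f e).1 (Or.inl hfe)

theorem exists_min_extension (B : OrderedBratteliDiagram) (n : ℕ) :
    ∀ z : ∀ i, B.E i, (∀ i, n ≤ i → B.tgt (z i) = B.src (z (i + 1))) →
      ∃ y : B.X, (∀ i, n ≤ i → y.1 i = z i) ∧ ∀ i < n, IsMin (y.1 i) := by
  induction n with
  | zero => exact fun z hz => ⟨⟨z, fun i => hz i (Nat.zero_le i)⟩, fun _ _ => rfl, by simp⟩
  | succ n ih =>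
    intro z hz
    obtain ⟨f, hf, hmin⟩ := B.exists_min_edge (B.src (z (n + 1)))
    obtain ⟨y, hy, hym⟩ := ih (Function.update z n f) (by
      intro i hi
      rcases hi.eq_or_lt with rfl | hi
      · simpa using hf
      · rw [Function.update_of_ne (by omega), Function.update_of_ne (by omega)]
        exact hz i hi)
    refine ⟨y, fun i hi => ?_, fun i hi => ?_⟩
    · rw [hy i (by omega), Function.update_of_ne (by omega)]
    · rcases (Nat.lt_succ_iff.1 hi).eq_or_lt with rfl | hi
      · rw [hy i le_rfl]; simpa using hmin
      · exact hym i hi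

theorem eq_of_isMin (B : OrderedBratteliDiagram) {n : ℕ} {e f : B.E n} (h : B.tgt e = B.tgt f)
    (he : IsMin e) (hf : IsMin f) : e = f := by
  rcases (B.comparable_iff e f).2 h with h | h
  · exact hf.eq_of_ge h |>.symm
  · exact he.eq_of_ge h

theorem existsUnique_vershikRel (B : OrderedBratteliDiagram) (hB : B.ProperlyOrdered) (x : B.X) :
    ∃! y, B.VershikRel x y := by
  classical
  by_cases hx : ∀ n, IsMax (x.1 n)
  · obtain ⟨y, hy, huniq⟩ := hB.2
    refine ⟨y, Or.inl ⟨hx, hy⟩, ?_⟩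
    rintro z (⟨-, hz⟩ | ⟨n, -, hz, -⟩)
    · exact huniq z hz
    · exact absurd hz.lt (hx n).not_lt
  · push Not at hx
    have hlt : ∀ i < Nat.find hx, IsMax (x.1 i) := fun i hi => not_not.1 (Nat.find_min hx hi)
    have hn : ¬ IsMax (x.1 (Nat.find hx)) := Nat.find_spec hx
    generalize Nat.find hx = n at hlt hn
    obtain ⟨g, hg⟩ := not_isMax_iff.1 hn
    obtain ⟨e, -, he⟩ := (Set.toFinite (Set.Ioi (x.1 n))).exists_le_minimal hg
    have hcov : x.1 n ⋖ e := ⟨he.1, fun c hc hce => (he.2 hc hce.le).not_gt hce⟩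
    have htgt : B.tgt e = B.tgt (x.1 n) := ((B.comparable_iff _ _).1 (Or.inl hcov.le)).symm
    obtain ⟨y, hy, hym⟩ := B.exists_min_extension n (Function.update x.1 n e) (by
      intro i hi
      rcases hi.eq_or_lt with rfl | hi
      · simp [htgt, x.2]
      · rw [Function.update_of_ne (by omega), Function.update_of_ne (by omega)]
        exact x.2 i)
    have hyn : y.1 n = e := by simpa using hy n le_rfl
    have hyi : ∀ i, n < i → y.1 i = x.1 i := fun i hi => by
      rw [hy i hi.le, Function.update_of_ne (by omega)]
    refine ⟨y, Or.inr ⟨n, hlt, hyn ▸ hcov, hym, hyi⟩, ?_⟩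
    rintro z (⟨hz, -⟩ | ⟨m, hm, hmz, hzm, hzi⟩)
    · exact absurd (hz n) hn
    · have hmn : m = n := by
        rcases lt_trichotomy m n with h | h | h
        · exact absurd hmz.lt (hlt m h).not_lt
        · exact h
        · exact absurd (hm n h) hn
      subst hmn
      have hzn : z.1 m = e := by
        have h1 : B.tgt (z.1 m) = B.tgt e := by
          rw [htgt]; exact ((B.comparable_iff _ _).1 (Or.inl hmz.le)).symm
        rcases (B.comparable_iff _ _).2 h1 with h | h
        · exact h.eq_or_lt.resolve_right (fun h => hcov.2 hmz.lt h)
        · exact (h.eq_or_lt.resolve_right (fun h => hmz.2 hcov.lt h)).symm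
      have hlow : ∀ j, j ≤ m → z.1 (m - j) = y.1 (m - j) := by
        intro j
        induction j with
        | zero => intro _; simp [hzn, hyn]
        | succ j ih =>
          intro hj
          have ih' := ih (by omega)
          obtain ⟨i, hi⟩ : ∃ i, m - j = i + 1 := ⟨m - j - 1, by omega⟩
          have hi' : m - (j + 1) = i := by omega
          rw [hi] at ih'
          rw [hi']
          refine B.eq_of_isMin ?_ (hzm i (by omega)) (hym i (by omega))
          rw [z.2, y.2, ih']
      apply Subtype.ext
      funext i
      rcases le_or_gt i m with h | h
      · have := hlow (m - i) (by omega)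
        rwa [Nat.sub_sub_self h] at this
      · rw [hzi i h, hyi i h]

theorem vershikRel_vershik (B : OrderedBratteliDiagram) (hB : B.ProperlyOrdered) (x : B.X) :
    B.VershikRel x (B.vershik x) := by
  have h := (B.existsUnique_vershikRel hB x).exists
  rw [vershik, dif_pos h]
  exact h.choose_spec

/-- `τ_n(x)`, the vertex of level `n` through which `x` passes, that is, the tower of the `n`-th
Kakutani-Rohlin partition which contains `x`. -/
def tau (B : OrderedBratteliDiagram) (n : ℕ) (x : B.X) : B.V n := B.src (x.1 n)

/-- `(t₁, t₂)` entry of the incidence matrix between level `n` and level `n + 1`. -/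
noncomputable def incidence (B : OrderedBratteliDiagram) (n : ℕ) (t₁ : B.V n) (t₂ : B.V (n + 1)) :
    ℕ :=
  Nat.card {e : B.E n // B.src e = t₁ ∧ B.tgt e = t₂}

/-- A proper diagram of rank `d`, together with the identification of the vertices of each level
`n ≥ 1` with `d` labels (the label of the root is irrelevant). -/
structure IsProper (B : OrderedBratteliDiagram) (d : ℕ) (lab : ∀ n, B.V n → Fin d) : Prop where
  properlyOrdered : B.ProperlyOrdered
  /-- (H1) from the root there is exactly one edge to each vertex of level `1` -/
  hat : ∀ (t₀ : B.V 0) (t : B.V 1), B.incidence 0 t₀ t = 1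
  /-- (H2) all the other incidence matrices are positive -/
  pos : ∀ n, 1 ≤ n → ∀ (t₁ : B.V n) (t₂ : B.V (n + 1)), 0 < B.incidence n t₁ t₂
  /-- (H3) there are `d` vertices at each level -/
  lab_bijective : ∀ n, 1 ≤ n → Function.Bijective (lab n)
  /-- (H4) all maximal edges of the same level start in the same vertex -/
  max_src : ∀ n, 1 ≤ n → ∀ e f : B.E n, IsMax e → IsMax f → B.src e = B.src f

/-- Toeplitz type with characteristic sequence `(q n)_{n ≥ 1}`: exactly `q (n + 1)` edges end at
each vertex of level `n + 1`. The value `q 0` is irrelevant. -/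
def IsToeplitz (B : OrderedBratteliDiagram) (q : ℕ → ℕ) : Prop :=
  ∀ n (t : B.V (n + 1)), Nat.card {e : B.E n // B.tgt e = t} = q (n + 1)

/-- Clean: `I μ` is the set of labels of the vertices whose towers have measure bounded from below
for the ergodic measure `μ`. -/
def IsClean (B : OrderedBratteliDiagram) {d : ℕ} (lab : ∀ n, B.V n → Fin d)
    (I : Measure B.X → Set (Fin d)) : Prop :=
  ∃ δ : ℝ, 0 < δ ∧
    (∀ μ : Measure B.X, IsProbabilityMeasure μ → Ergodic B.vershik μ →
      (∀ t ∈ I μ, ∀ n, 1 ≤ n → δ ≤ μ.real {x | lab n (B.tau n x) = t}) ∧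
      (∀ t ∉ I μ, Tendsto (fun n => μ.real {x | lab n (B.tau n x) = t}) atTop (𝓝 0))) ∧
    (∀ μ ν : Measure B.X, IsProbabilityMeasure μ → Ergodic B.vershik μ →
      IsProbabilityMeasure ν → Ergodic B.vershik ν → μ ≠ ν → Disjoint (I μ) (I ν))

/-- The set `E_{m,n}` of finite paths from level `m` to level `n`. -/
def Segment (B : OrderedBratteliDiagram) (m n : ℕ) : Type :=
  {e : ∀ i : Set.Ico m n, B.E i //
    ∀ i (h : i ∈ Set.Ico m n) (h' : i + 1 ∈ Set.Ico m n),
      B.tgt (e ⟨i, h⟩) = B.src (e ⟨i + 1, h'⟩)}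

instance (B : OrderedBratteliDiagram) (m n : ℕ) : Finite (B.Segment m n) :=
  inferInstanceAs (Finite (Subtype _))

/-- The part of the infinite path `x` between level `m` and level `n`. -/
def segment (B : OrderedBratteliDiagram) (m n : ℕ) (x : B.X) : B.Segment m n :=
  ⟨fun i => x.1 i, fun i _ _ => x.2 i⟩

/-- The finite path `e` ends at the vertex `τ_n(x)` (for `m < n`). -/
def EndsAt (B : OrderedBratteliDiagram) {m n : ℕ} (e : B.Segment m n) (x : B.X) : Prop :=
  ∀ i (h : i ∈ Set.Ico m n), i + 1 = n → B.tgt (e.1 ⟨i, h⟩) = B.tau (i + 1) x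

/-- The strict order induced on `E_{m,n}`: compare the last edges that differ. -/
def SegmentLT (B : OrderedBratteliDiagram) {m n : ℕ} (e f : B.Segment m n) : Prop :=
  ∃ i : Set.Ico m n, e.1 i < f.1 i ∧ ∀ j : Set.Ico m n, i < j → e.1 j = f.1 j

/-- The suffix count `s̄_{m,n}(x)`: the number of paths in `E_{m,n}` which end at `τ_n(x)` and are
strictly bigger than the part of `x` between levels `m` and `n`. -/
noncomputable def suffixCount (B : OrderedBratteliDiagram) (m n : ℕ) (x : B.X) : ℕ :=
  Nat.card {f : B.Segment m n // B.EndsAt f x ∧ B.SegmentLT (B.segment m n x) f}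

end OrderedBratteliDiagram

/-- `p_n = q_1 q_2 ⋯ q_n`. -/
def pSeq (q : ℕ → ℕ) (n : ℕ) : ℕ := ∏ i ∈ Finset.Icc 1 n, q i

/-- `z` is a continuous eigenvalue of `(X, T)`. -/
def IsContinuousEigenvalue {X : Type*} [TopologicalSpace X] (T : X → X) (z : ℂ) : Prop :=
  ∃ f : X → ℂ, Continuous f ∧ f ≠ 0 ∧ ∀ x, f (T x) = z * f x

/-- `z` is an eigenvalue of `(X, T)` with respect to `μ`. -/
def IsMeasurableEigenvalue {X : Type*} [MeasurableSpace X] (T : X → X) (μ : Measure X) (z : ℂ) :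
    Prop :=
  ∃ f : X → ℂ, MemLp f 2 μ ∧ (¬ f =ᵐ[μ] 0) ∧ ∀ᵐ x ∂μ, f (T x) = z * f x

/-- `ν` is the sequence of levels of a telescoping. The telescoped diagram has the vertex sets
`V_{ν k}` and the edge sets `E_{ν k, ν (k+1)}` with the induced order; hence at level `k` its
`p`, `τ` and `s̄` are `p_{ν k}`, `τ_{ν k}` and `s̄_{ν k, ν (k+1)}`. -/
def IsTelescoping (ν : ℕ → ℕ) : Prop := StrictMono ν ∧ ν 0 = 0

/-! Write r_n(x) = `segRank q 0 n x` for the number of paths from the root to τ_n(x) that are bigger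
than the beginning of x. Because the number of edges into a vertex depends only on its level, r_n is
a mixed radix number whose digits are the ranks of the edges, and the Vershik map acts on it as
subtraction of 1 modulo p_n. In this numeration the suffix count is a block of digits, so r_n = r_m
+ p_m s̄_{m,n}.

Let λ have order b. It is a continuous eigenvalue exactly when b divides some p_n: then λ^(-r_n) is
an eigenfunction, and conversely the return times p_n near the minimal path force λ^(p_n) → 1
(`isContinuousEigenvalue_iff`).

A measurable eigenfunction amounts, by ergodicity, to a map φ into `ZMod b` with φ∘T = φ + 1
(`exists_zmod_cocycle_of_eigenvalue`). The sum φ + r_n does not change along a tower of level n, and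
martingale convergence shows that it is close in measure to a colour ρ_n(τ_n)
(`exists_tower_coloring_tendsto`). There are finitely many colourings and residues, so along a
subsequence ρ_n = ρ and p_n ≡ p, with summable errors. By Borel–Cantelli, almost surely p s̄ ≡ ρ(τ')
- ρ(τ) for consecutive levels of the subsequence. The colours of labels in I_μ agree modulo gcd(b,
p), again by ergodicity, so each difference ρ(t₂) - ρ(t₁) is p k(t₁, t₂), with k determined modulo b
/ gcd(b, p). This quotient is at most d because T^(p_n) fixes r_n and translates φ by p_n: whole
cosets of colours have equal measure and need distinct labels (`div_gcd_le_of_coloring`).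

Conversely, p k(t₀, ·) with a fixed t₀ is a colouring ρ for which λ^(ρ(τ_n) - r_n) is almost surely
eventually constant along the telescoping, and its limit is an eigenfunction
(`isMeasurableEigenvalue_of_coloring`). The condition that the quotient exceeds 1 is what prevents b
from dividing any p_n. -/

namespace OrderedBratteliDiagram

/-! ### Mixed radix coordinates of paths and suffix counts. -/

variable {B : OrderedBratteliDiagram} {q : ℕ → ℕ}

/-- The number of edges strictly bigger than `e`. -/
noncomputable def edgeRank {n : ℕ} (e : B.E n) : ℕ := (Set.Ioi e).ncard

theorem edgeRank_eq_zero_iff {n : ℕ} {e : B.E n} : edgeRank e = 0 ↔ IsMax e := by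
  rw [edgeRank, Set.ncard_eq_zero, Set.Ioi_eq_empty_iff]

theorem edgeRank_lt_of_lt {n : ℕ} {e f : B.E n} (h : e < f) : edgeRank f < edgeRank e :=
  Set.ncard_lt_ncard (Set.Ioi_ssubset_Ioi h)

theorem tgt_eq_of_le {n : ℕ} {e f : B.E n} (h : e ≤ f) : B.tgt e = B.tgt f :=
  (B.comparable_iff e f).1 (Or.inl h)

theorem lt_trichotomy_of_tgt_eq {n : ℕ} {e f : B.E n} (h : B.tgt e = B.tgt f) :
    e < f ∨ e = f ∨ f < e := by
  rcases (B.comparable_iff e f).2 h with h | h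
  · rcases h.lt_or_eq with h | h <;> simp [h]
  · rcases h.lt_or_eq with h | h <;> simp [h]

theorem edgeRank_lt_edgeRank_iff {n : ℕ} {e f : B.E n} (h : B.tgt e = B.tgt f) :
    edgeRank f < edgeRank e ↔ e < f := by
  refine ⟨fun hr => ?_, edgeRank_lt_of_lt⟩
  rcases lt_trichotomy_of_tgt_eq h with h | rfl | h
  · exact h
  · exact absurd hr (lt_irrefl _)
  · exact absurd hr (edgeRank_lt_of_lt h).not_gt

theorem edgeRank_injOn {n : ℕ} {e f : B.E n} (h : B.tgt e = B.tgt f)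
    (hr : edgeRank e = edgeRank f) : e = f := by
  rcases lt_trichotomy_of_tgt_eq h with h | h | h
  · exact absurd hr (edgeRank_lt_of_lt h).ne'
  · exact h
  · exact absurd hr (edgeRank_lt_of_lt h).ne

theorem edgeRank_lt (hq : B.IsToeplitz q) {n : ℕ} (e : B.E n) : edgeRank e < q (n + 1) := by
  rw [← hq n (B.tgt e), ← Set.coe_ofPred, Nat.card_coe_set_eq]
  refine Set.ncard_lt_ncard ⟨fun f hf => (tgt_eq_of_le (le_of_lt hf)).symm, fun h => ?_⟩
  exact lt_irrefl e (h (show B.tgt e = B.tgt e from rfl))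

/-- Ranks inject the edges ending at t into `Fin (q (n + 1))`, and both sets have the same
cardinality. -/
theorem exists_edgeRank_eq (hq : B.IsToeplitz q) {n : ℕ} (t : B.V (n + 1)) {k : ℕ}
    (hk : k < q (n + 1)) : ∃ e : B.E n, B.tgt e = t ∧ edgeRank e = k := by
  have hinj : Function.Injective
      (fun e : {e : B.E n // B.tgt e = t} => (⟨edgeRank e.1, edgeRank_lt hq e.1⟩ : Fin (q (n + 1))))
      := fun e f hef => Subtype.ext (edgeRank_injOn (e.2.trans f.2.symm) (Fin.mk.inj_iff.1 hef))
  obtain ⟨e, he⟩ := ((Nat.bijective_iff_injective_and_card _).2 ⟨hinj, by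
    rw [hq n t, Nat.card_eq_fintype_card, Fintype.card_fin]⟩).2 ⟨k, hk⟩
  exact ⟨e.1, e.2, Fin.mk.inj_iff.1 he⟩

theorem edgeRank_add_one_of_isMin (hq : B.IsToeplitz q) {n : ℕ} {e : B.E n} (he : IsMin e) :
    edgeRank e + 1 = q (n + 1) := by
  have hlt := edgeRank_lt hq e
  obtain ⟨f, hf, hfr⟩ := exists_edgeRank_eq hq (B.tgt e) (k := q (n + 1) - 1) (by omega)
  rcases lt_trichotomy_of_tgt_eq hf with h | rfl | h
  · exact absurd h he.not_lt
  · omega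
  · have := edgeRank_lt_of_lt h; omega

theorem edgeRank_add_one_eq_iff (hq : B.IsToeplitz q) {n : ℕ} {e : B.E n} :
    edgeRank e + 1 = q (n + 1) ↔ IsMin e := by
  refine ⟨fun h => ?_, edgeRank_add_one_of_isMin hq⟩
  obtain ⟨f, hf, hmin⟩ := B.exists_min_edge (B.tgt e)
  have := edgeRank_add_one_of_isMin hq hmin
  rwa [edgeRank_injOn hf.symm (show edgeRank e = edgeRank f by omega)]

theorem edgeRank_of_covBy (hq : B.IsToeplitz q) {n : ℕ} {e f : B.E n} (h : e ⋖ f) :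
    edgeRank e = edgeRank f + 1 := by
  have h1 := edgeRank_lt_of_lt h.lt
  by_contra hne
  obtain ⟨g, hg, hgr⟩ := exists_edgeRank_eq hq (B.tgt e) (k := edgeRank f + 1)
    (by have := edgeRank_lt hq e; omega)
  exact h.2 ((edgeRank_lt_edgeRank_iff hg.symm).1 (by omega))
    ((edgeRank_lt_edgeRank_iff (hg.trans (tgt_eq_of_le h.le))).1 (by omega))

/-- The number of finite paths from level `m` to a given vertex of level `n`. -/
def segProd (q : ℕ → ℕ) (m n : ℕ) : ℕ := ∏ i ∈ Finset.Ico m n, q (i + 1)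

theorem segProd_self (m : ℕ) : segProd q m m = 1 := by simp [segProd]

theorem segProd_succ {m n : ℕ} (h : m ≤ n) :
    segProd q m (n + 1) = segProd q m n * q (n + 1) :=
  Finset.prod_Ico_succ_top h _

theorem segProd_mul {l m n : ℕ} (h : l ≤ m) (h' : m ≤ n) :
    segProd q l m * segProd q m n = segProd q l n :=
  Finset.prod_Ico_consecutive _ h h'

theorem pSeq_eq_segProd (n : ℕ) : pSeq q n = segProd q 0 n := by
  rw [pSeq, segProd, Finset.prod_Ico_add' q 0 n 1]
  rfl

theorem pSeq_dvd_pSeq {m n : ℕ} (h : m ≤ n) : pSeq q m ∣ pSeq q n := by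
  rw [pSeq_eq_segProd, pSeq_eq_segProd, ← segProd_mul (Nat.zero_le m) h]
  exact Dvd.intro _ rfl

/-- The rank of the part of `x` between the levels `m` and `n` for the reversed order. -/
noncomputable def segRank (q : ℕ → ℕ) (m n : ℕ) (x : B.X) : ℕ :=
  ∑ i ∈ Finset.Ico m n, segProd q m i * edgeRank (x.1 i)

theorem segRank_succ {m n : ℕ} (h : m ≤ n) (x : B.X) :
    segRank q m (n + 1) x = segRank q m n x + segProd q m n * edgeRank (x.1 n) :=
  Finset.sum_Ico_succ_top h _

theorem segRank_self (m : ℕ) (x : B.X) : segRank q m m x = 0 := by simp [segRank]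

theorem segRank_congr {m n : ℕ} {x y : B.X} (h : ∀ i, m ≤ i → i < n → x.1 i = y.1 i) :
    segRank q m n x = segRank q m n y :=
  Finset.sum_congr rfl fun i hi => by
    rw [Finset.mem_Ico] at hi
    rw [h i hi.1 hi.2]

theorem segRank_add {l m n : ℕ} (h : l ≤ m) (h' : m ≤ n) (x : B.X) :
    segRank q l n x = segRank q l m x + segProd q l m * segRank q m n x := by
  rw [segRank, segRank, segRank, ← Finset.sum_Ico_consecutive _ h h', Finset.mul_sum]
  congr 1
  refine Finset.sum_congr rfl fun i hi => ?_
  rw [Finset.mem_Ico] at hi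
  rw [← segProd_mul h hi.1, mul_assoc]

theorem segRank_lt (hq : B.IsToeplitz q) {m n : ℕ} (h : m ≤ n) (x : B.X) :
    segRank q m n x < segProd q m n := by
  induction n, h using Nat.le_induction with
  | base => simp [segRank_self, segProd_self]
  | succ n h ih =>
    rw [segRank_succ h, segProd_succ h]
    have := Nat.mul_le_mul_left (segProd q m n) (Nat.succ_le_of_lt (edgeRank_lt hq (x.1 n)))
    rw [Nat.mul_succ] at this
    omega

theorem segRank_add_one_iff (hq : B.IsToeplitz q) {m n : ℕ} (h : m ≤ n) (x : B.X) :
    segRank q m n x + 1 = segProd q m n ↔ ∀ i, m ≤ i → i < n → IsMin (x.1 i) := by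
  induction n, h using Nat.le_induction with
  | base =>
    simp only [segRank_self, segProd_self, zero_add, true_iff]
    intro i h1 h2; omega
  | succ n h ih =>
    have h1 := segRank_lt hq h x
    have h2 := edgeRank_lt hq (x.1 n)
    have key : segRank q m (n + 1) x + 1 = segProd q m (n + 1) ↔
        segRank q m n x + 1 = segProd q m n ∧ edgeRank (x.1 n) + 1 = q (n + 1) := by
      rw [segRank_succ h, segProd_succ h]
      constructor
      · intro h3
        have h4 : edgeRank (x.1 n) + 1 = q (n + 1) := by
          by_contra hne
          have := Nat.mul_le_mul_left (segProd q m n)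
            (show edgeRank (x.1 n) + 2 ≤ q (n + 1) by omega)
          rw [Nat.mul_add] at this
          omega
        rw [← h4, Nat.mul_succ] at h3
        exact ⟨by omega, h4⟩
      · rintro ⟨h3, h4⟩
        rw [← h4, Nat.mul_succ]
        omega
    rw [key, ih, edgeRank_add_one_eq_iff hq]
    constructor
    · rintro ⟨ha, hb⟩ i hi hin
      rcases (Nat.lt_succ_iff.1 hin).lt_or_eq with hlt | rfl
      · exact ha i hi hlt
      · exact hb
    · exact fun ha => ⟨fun i hi hin => ha i hi (by omega), ha n h (by omega)⟩

theorem segRank_eq_zero {m n : ℕ} {x : B.X} (h : ∀ i, m ≤ i → i < n → IsMax (x.1 i)) :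
    segRank q m n x = 0 :=
  Finset.sum_eq_zero fun i hi => by
    rw [Finset.mem_Ico] at hi
    rw [edgeRank_eq_zero_iff.2 (h i hi.1 hi.2), mul_zero]

/-- A rank determines the edge only once its end-point is known, so the digits are decoded downwards
from level n: each edge found gives the end-point of the previous one. -/
theorem edge_eq_of_tau_eq (hq : B.IsToeplitz q) {m n : ℕ} (h : m ≤ n) {x y : B.X}
    (hτ : B.tau n x = B.tau n y) (hr : segRank q m n x = segRank q m n y) :
    ∀ i, m ≤ i → i < n → x.1 i = y.1 i := by
  induction n, h using Nat.le_induction with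
  | base => intro i h1 h2; omega
  | succ n h ih =>
    have htgt : B.tgt (x.1 n) = B.tgt (y.1 n) := by simpa [x.2, y.2, tau] using hτ
    rw [segRank_succ h, segRank_succ h] at hr
    have hx := segRank_lt hq h x
    have hy := segRank_lt hq h y
    have h1 : edgeRank (x.1 n) = edgeRank (y.1 n) := by
      have := congrArg (· / segProd q m n) hr
      simpa [Nat.add_mul_div_left _ _ (Nat.zero_lt_of_lt hx), Nat.div_eq_of_lt hx,
        Nat.div_eq_of_lt hy] using this
    have hn : x.1 n = y.1 n := edgeRank_injOn htgt h1
    have := ih (by rw [tau, tau, hn]) (by rw [h1] at hr; omega)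
    intro i hi hin
    rcases (Nat.lt_succ_iff.1 hin).lt_or_eq with hlt | rfl
    · exact this i hi hlt
    · exact hn

/-- How the Vershik map moves a point inside the tower of level `n`. -/
theorem segRank_vershik (hB : B.ProperlyOrdered) (hq : B.IsToeplitz q) (n : ℕ) (x : B.X) :
    (segRank q 0 n x = 0 ∧ segRank q 0 n (B.vershik x) + 1 = segProd q 0 n) ∨
      (segRank q 0 n (B.vershik x) + 1 = segRank q 0 n x ∧
        ∀ i, n ≤ i → (B.vershik x).1 i = x.1 i) := by
  rcases B.vershikRel_vershik hB x with ⟨hx, hy⟩ | ⟨N, hx, hc, hy, he⟩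
  · exact Or.inl ⟨segRank_eq_zero fun i _ _ => hx i,
      (segRank_add_one_iff hq (Nat.zero_le n) _).2 fun i _ _ => hy i⟩
  · rcases le_or_gt n N with hn | hn
    · exact Or.inl ⟨segRank_eq_zero fun i _ h => hx i (by omega),
        (segRank_add_one_iff hq (Nat.zero_le n) _).2 fun i _ h => hy i (by omega)⟩
    · refine Or.inr ⟨?_, fun i hi => he i (by omega)⟩
      -- A borrow: the digits below N pass from 0 to their largest values while digit N drops by
      -- one.
      rw [segRank_add (Nat.zero_le (N + 1)) hn, segRank_add (Nat.zero_le (N + 1)) hn x,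
        segRank_congr (fun i h1 _ => he i (by omega) : ∀ i, N + 1 ≤ i → i < n → _),
        segRank_succ (Nat.zero_le N), segRank_succ (Nat.zero_le N), edgeRank_of_covBy hq hc,
        segRank_eq_zero fun i _ h => hx i h]
      have := (segRank_add_one_iff hq (Nat.zero_le N) (B.vershik x)).2 fun i _ h => hy i h
      rw [Nat.mul_succ]
      omega

theorem exists_segRank_eq (hq : B.IsToeplitz q) {m n : ℕ} (h : m ≤ n) (x : B.X) {k : ℕ}
    (hk : k < segProd q m n) :
    ∃ y : B.X, (∀ i, n ≤ i → y.1 i = x.1 i) ∧ segRank q m n y = k := by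
  induction n, h using Nat.le_induction generalizing x k with
  | base => exact ⟨x, fun _ _ => rfl, by simp_all [segRank_self, segProd_self]⟩
  | succ n h ih =>
    rw [segProd_succ h] at hk
    have hpos : 0 < segProd q m n := Nat.pos_of_mul_pos_right (Nat.zero_lt_of_lt hk)
    obtain ⟨e, he, her⟩ := exists_edgeRank_eq hq (B.tgt (x.1 n))
      (Nat.div_lt_of_lt_mul hk : k / segProd q m n < q (n + 1))
    obtain ⟨z, hz, -⟩ := B.exists_min_extension n (Function.update x.1 n e) (by
      intro i hi
      rcases hi.eq_or_lt with rfl | hi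
      · simp [he, x.2]
      · rw [Function.update_of_ne (by omega), Function.update_of_ne (by omega)]
        exact x.2 i)
    obtain ⟨y, hy, hyr⟩ := ih z (Nat.mod_lt k hpos)
    have hyn : y.1 n = e := by rw [hy n le_rfl, hz n le_rfl]; simp
    refine ⟨y, fun i hi => ?_, ?_⟩
    · rw [hy i (by omega), hz i (by omega), Function.update_of_ne (by omega)]
    · rw [segRank_succ h, hyr, hyn, her, Nat.mod_add_div]

theorem tau_eq_of_edge_eq {n : ℕ} {x y : B.X} (h : ∀ i, n ≤ i → y.1 i = x.1 i) :
    B.tau n y = B.tau n x := by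
  rw [tau, tau, h n le_rfl]

/-- A segment ending at `τ_n(x)` is a part of an infinite path which agrees with `x` after `n`. -/
theorem exists_path_of_endsAt {m n : ℕ} (x : B.X) (f : B.Segment m n) (hf : B.EndsAt f x) :
    ∃ y : B.X, (∀ i, n ≤ i → y.1 i = x.1 i) ∧ B.segment m n y = f := by
  classical
  rcases le_or_gt n m with hmn | hmn
  · exact ⟨x, fun _ _ => rfl, Subtype.ext (funext fun i => by have := i.2.1; have := i.2.2; omega)⟩
  obtain ⟨y, hy, -⟩ := B.exists_min_extension m
    (fun i => if h : i ∈ Set.Ico m n then f.1 ⟨i, h⟩ else x.1 i) (by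
      intro i hi
      rcases lt_trichotomy (i + 1) n with h | h | h
      · have h1 : i ∈ Set.Ico m n := ⟨hi, by omega⟩
        have h2 : i + 1 ∈ Set.Ico m n := ⟨by omega, h⟩
        rw [dif_pos h1, dif_pos h2]
        exact f.2 i h1 h2
      · have h1 : i ∈ Set.Ico m n := ⟨hi, by omega⟩
        have h2 : i + 1 ∉ Set.Ico m n := fun h' => by have := h'.2; omega
        rw [dif_pos h1, dif_neg h2]
        exact hf i h1 h
      · have h1 : i ∉ Set.Ico m n := fun h' => by have := h'.2; omega
        have h2 : i + 1 ∉ Set.Ico m n := fun h' => by have := h'.2; omega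
        rw [dif_neg h1, dif_neg h2]
        exact x.2 i)
  refine ⟨y, fun i hi => ?_, Subtype.ext (funext fun i => ?_)⟩
  · rw [hy i (by omega), dif_neg fun h' => by have := h'.2; omega]
  · exact (hy i i.2.1).trans (dif_pos i.2)

theorem endsAt_segment {m n : ℕ} {x y : B.X} (h : ∀ i, n ≤ i → y.1 i = x.1 i) :
    B.EndsAt (B.segment m n y) x := by
  rintro i hi rfl
  change B.tgt (y.1 i) = B.src (x.1 (i + 1))
  rw [y.2, h _ le_rfl]

theorem segRank_lt_of_segmentLT (hq : B.IsToeplitz q) {m n : ℕ} {x y : B.X}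
    (h : B.SegmentLT (B.segment m n x) (B.segment m n y)) :
    segRank q m n y < segRank q m n x := by
  obtain ⟨⟨i, hmi, hin⟩, hlt, heq⟩ := h
  have hlt' : x.1 i < y.1 i := hlt
  have heq' : ∀ j, i + 1 ≤ j → j < n → y.1 j = x.1 j := fun j h1 h2 =>
    (heq ⟨j, by omega, h2⟩ h1).symm
  rw [segRank_add (m := i + 1) (by omega) hin, segRank_add (m := i + 1) (by omega) hin x,
    segRank_congr heq', segRank_succ hmi, segRank_succ hmi]
  have h1 := segRank_lt hq hmi y
  have h2 := Nat.mul_le_mul_left (segProd q m i) (Nat.succ_le_of_lt (edgeRank_lt_of_lt hlt'))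
  rw [Nat.mul_succ] at h2
  omega

theorem segmentLT_trichotomy {m n : ℕ} (h : m ≤ n) {x y : B.X} (hτ : B.tau n x = B.tau n y) :
    B.SegmentLT (B.segment m n x) (B.segment m n y) ∨ (∀ i, m ≤ i → i < n → x.1 i = y.1 i) ∨
      B.SegmentLT (B.segment m n y) (B.segment m n x) := by
  induction n, h using Nat.le_induction with
  | base => exact Or.inr (Or.inl fun i h1 h2 => by omega)
  | succ n h ih =>
    have htgt : B.tgt (x.1 n) = B.tgt (y.1 n) := by simpa [x.2, y.2, tau] using hτ
    rcases lt_trichotomy_of_tgt_eq htgt with hn | hn | hn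
    · refine Or.inl ⟨⟨n, h, by omega⟩, hn, fun j hj => ?_⟩
      have h1 := j.2.2
      have h2 : n < j.1 := hj
      omega
    · have hext : ∀ u v : B.X, u.1 n = v.1 n → B.SegmentLT (B.segment m n u) (B.segment m n v) →
          B.SegmentLT (B.segment m (n + 1) u) (B.segment m (n + 1) v) := by
        rintro u v huv ⟨⟨i, hi⟩, hlt, heq⟩
        refine ⟨⟨i, hi.1, by have := hi.2; omega⟩, hlt, ?_⟩
        rintro ⟨j, hj⟩ hij
        rcases (Nat.lt_succ_iff.1 hj.2).lt_or_eq with h' | rfl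
        · exact heq ⟨j, hj.1, h'⟩ hij
        · exact huv
      rcases ih (by rw [tau, tau, hn]) with h' | h' | h'
      · exact Or.inl (hext _ _ hn h')
      · refine Or.inr (Or.inl fun i hi hin => ?_)
        rcases (Nat.lt_succ_iff.1 hin).lt_or_eq with hlt | rfl
        · exact h' i hi hlt
        · exact hn
      · exact Or.inr (Or.inr (hext _ _ hn.symm h'))
    · refine Or.inr (Or.inr ⟨⟨n, h, by omega⟩, hn, fun j hj => ?_⟩)
      have h1 := j.2.2
      have h2 : n < j.1 := hj
      omega

/-- Bigger segments have smaller rank, and each rank is taken by exactly one segment ending at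
τ_n(x); so the segments above that of x correspond to the ranks below its own. -/
theorem suffixCount_eq_segRank (hq : B.IsToeplitz q) {m n : ℕ} (h : m ≤ n) (x : B.X) :
    B.suffixCount m n x = segRank q m n x := by
  have hlt := segRank_lt hq h x
  choose y hy hyr using fun k : Fin (segRank q m n x) =>
    exists_segRank_eq hq h x (k.2.trans hlt)
  have hLT : ∀ k, B.SegmentLT (B.segment m n x) (B.segment m n (y k)) := by
    intro k
    rcases segmentLT_trichotomy h (tau_eq_of_edge_eq (hy k)).symm with h' | h' | h'
    · exact h'
    · have := segRank_congr (q := q) h'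
      have := hyr k
      have := k.2
      omega
    · have := segRank_lt_of_segmentLT hq h'
      have := hyr k
      have := k.2
      omega
  have hbij : Function.Bijective (fun k : Fin (segRank q m n x) =>
      (⟨B.segment m n (y k), endsAt_segment (hy k), hLT k⟩ :
        {f : B.Segment m n // B.EndsAt f x ∧ B.SegmentLT (B.segment m n x) f})) := by
    have hseg : ∀ {u v : B.X}, B.segment m n u = B.segment m n v →
        segRank q m n u = segRank q m n v := fun huv => segRank_congr fun i h1 h2 =>
      congrFun (congrArg Subtype.val huv) ⟨i, h1, h2⟩
    constructor
    · intro k l hkl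
      have := hseg (congrArg Subtype.val hkl)
      rw [hyr, hyr] at this
      exact Fin.ext this
    · rintro ⟨f, hf, hxf⟩
      obtain ⟨z, hz, rfl⟩ := exists_path_of_endsAt x f hf
      refine ⟨⟨segRank q m n z, segRank_lt_of_segmentLT hq hxf⟩, Subtype.ext ?_⟩
      refine Subtype.ext (funext fun i => ?_)
      refine edge_eq_of_tau_eq hq h ?_ (hyr _) i i.2.1 i.2.2
      rw [tau_eq_of_edge_eq (hy _), tau_eq_of_edge_eq hz]
  rw [suffixCount, ← Nat.card_congr (Equiv.ofBijective _ hbij), Nat.card_eq_fintype_card,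
    Fintype.card_fin]

end OrderedBratteliDiagram

/-! ### Topology of the path space and continuous eigenvalues. -/

namespace OrderedBratteliDiagram

variable {B : OrderedBratteliDiagram} {q : ℕ → ℕ}

/-- The first `n` edges of a path. -/
def initialPath (n : ℕ) (x : B.X) : ∀ i : Fin n, B.E i := fun i => x.1 i

theorem initialPath_eq_iff {n : ℕ} {x y : B.X} :
    initialPath n x = initialPath n y ↔ ∀ i < n, x.1 i = y.1 i :=
  ⟨fun h i hi => congrFun h ⟨i, hi⟩, fun h => funext fun i => h i i.2⟩

theorem isOpen_of_initialPath (n : ℕ) {S : Set B.X}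
    (h : ∀ x y : B.X, (∀ i < n, x.1 i = y.1 i) → x ∈ S → y ∈ S) : IsOpen S := by
  let : ∀ i, TopologicalSpace (B.E i) := fun _ => ⊥
  have : ∀ i, DiscreteTopology (B.E i) := fun _ => ⟨rfl⟩
  have hc : Continuous (initialPath n : B.X → _) := by
    refine continuous_pi fun i => ?_
    exact (continuous_apply (i : ℕ)).comp (continuous_induced_dom (f := fun x : B.X => x.1))
  have : S = initialPath n ⁻¹' (initialPath n '' S) := by
    refine Set.Subset.antisymm (Set.subset_preimage_image _ _) ?_
    rintro y ⟨x, hx, hxy⟩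
    exact h x y (initialPath_eq_iff.1 hxy) hx
  rw [this]
  exact (isOpen_discrete _).preimage hc

theorem continuous_of_initialPath (n : ℕ) {Y : Type*} [TopologicalSpace Y] {f : B.X → Y}
    (h : ∀ x y : B.X, (∀ i < n, x.1 i = y.1 i) → f x = f y) : Continuous f :=
  ⟨fun s _ => isOpen_of_initialPath n fun x y hxy hx => by
    rw [Set.mem_preimage, ← h x y hxy]; exact hx⟩

theorem measurable_of_initialPath (n : ℕ) {Y : Type*} [MeasurableSpace Y] {f : B.X → Y}
    (h : ∀ x y : B.X, (∀ i < n, x.1 i = y.1 i) → f x = f y) : Measurable f :=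
  fun s _ => (isOpen_of_initialPath n fun x y hxy hx => by
    rw [Set.mem_preimage, ← h x y hxy]; exact hx).measurableSet

theorem segRank_congr_initialPath {n : ℕ} {x y : B.X} (h : ∀ i < n, x.1 i = y.1 i) :
    segRank q 0 n x = segRank q 0 n y := segRank_congr fun i _ hi => h i hi

theorem measurable_segRank (n : ℕ) : Measurable (segRank q 0 n : B.X → ℕ) :=
  measurable_of_initialPath n fun _ _ h => segRank_congr_initialPath h

theorem tau_congr {n : ℕ} {x y : B.X} (h : ∀ i < n + 1, x.1 i = y.1 i) :
    B.tau n x = B.tau n y := by rw [tau, tau, h n (by omega)]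

instance : CompactSpace B.X := by
  let : ∀ i, TopologicalSpace (B.E i) := fun _ => ⊥
  have : ∀ i, DiscreteTopology (B.E i) := fun _ => ⟨rfl⟩
  have hemb : Topology.IsInducing (fun x : B.X => x.1) := ⟨rfl⟩
  have hcl : IsClosed (Set.range (fun x : B.X => x.1)) := by
    have : Set.range (fun x : B.X => x.1) =
        ⋂ n, {z : ∀ i, B.E i | B.tgt (z n) = B.src (z (n + 1))} := by
      ext z
      simp only [Set.mem_range, Set.mem_iInter, Set.mem_ofPred_eq]
      exact ⟨by rintro ⟨x, rfl⟩; exact x.2, fun h => ⟨⟨z, h⟩, rfl⟩⟩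
    rw [this]
    refine isClosed_iInter fun n => ?_
    have hc : Continuous (fun z : ∀ i, B.E i => (z n, z (n + 1))) :=
      (continuous_apply n).prodMk (continuous_apply (n + 1))
    exact (isClosed_discrete {p : B.E n × B.E (n + 1) | B.tgt p.1 = B.src p.2}).preimage hc
  exact ⟨hemb.isCompact_iff.2 (by rw [Set.image_univ]; exact hcl.isCompact)⟩

/-- By compactness it suffices that every cluster point is a path of minimal edges. -/
theorem tendsto_of_isMin {y : ℕ → B.X} (hy : ∀ n, ∀ i < n, IsMin ((y n).1 i)) {z : B.X}
    (huniq : ∀ w : B.X, (∀ n, IsMin (w.1 n)) → w = z) : Tendsto y atTop (𝓝 z) := by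
  refine le_nhds_of_unique_clusterPt fun w hw => huniq w fun i => ?_
  have hopen : IsOpen {u : B.X | u.1 i = w.1 i} := isOpen_of_initialPath (i + 1)
    fun u v huv hu => (huv i (by omega)).symm.trans hu
  have hfreq : ∃ᶠ n in atTop, (y n).1 i = w.1 i :=
    (MapClusterPt.frequently hw (hopen.mem_nhds rfl))
  obtain ⟨n, hn, hni⟩ := (hfreq.and_eventually (eventually_gt_atTop i)).exists
  rw [← hn]
  exact hy n i hni

theorem segProd_pos (hq : B.IsToeplitz q) (x : B.X) (n : ℕ) : 0 < segProd q 0 n :=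
  Nat.zero_lt_of_lt (segRank_lt hq (Nat.zero_le n) x)

theorem segRank_vershik_modEq (hB : B.ProperlyOrdered) (hq : B.IsToeplitz q) (n : ℕ) (x : B.X) :
    segRank q 0 n (B.vershik x) + 1 ≡ segRank q 0 n x [MOD segProd q 0 n] := by
  rcases segRank_vershik hB hq n x with ⟨h1, h2⟩ | ⟨h1, -⟩
  · rw [h1, h2]; simp [Nat.ModEq]
  · rw [h1]

theorem segRank_iterate_modEq (hB : B.ProperlyOrdered) (hq : B.IsToeplitz q) (n k : ℕ) (x : B.X) :
    segRank q 0 n (B.vershik^[k] x) + k ≡ segRank q 0 n x [MOD segProd q 0 n] := by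
  induction k generalizing x with
  | zero => rfl
  | succ k ih =>
    rw [Function.iterate_succ_apply, ← add_assoc]
    exact ((ih _).add_right 1).trans (segRank_vershik_modEq hB hq n x)

theorem segRank_iterate_segProd (hB : B.ProperlyOrdered) (hq : B.IsToeplitz q) (n : ℕ) (x : B.X) :
    segRank q 0 n (B.vershik^[segProd q 0 n] x) = segRank q 0 n x := by
  have h := segRank_iterate_modEq hB hq n (segProd q 0 n) x
  have h' : segRank q 0 n (B.vershik^[segProd q 0 n] x) + segProd q 0 n ≡
      segRank q 0 n (B.vershik^[segProd q 0 n] x) [MOD segProd q 0 n] := by simp [Nat.ModEq]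
  exact (h'.symm.trans h).eq_of_lt_of_lt (segRank_lt hq (Nat.zero_le n) _)
    (segRank_lt hq (Nat.zero_le n) _)

theorem exists_iterate_isMin (hB : B.ProperlyOrdered) (hq : B.IsToeplitz q) (n : ℕ) (x : B.X) :
    ∃ k, ∀ i < n, IsMin ((B.vershik^[k] x).1 i) := by
  have hlt := segRank_lt hq (Nat.zero_le n) x
  -- After r_n(x) steps the orbit is at rank 0; one more step wraps around to rank p_n - 1, the
  -- minimal path.
  refine ⟨segRank q 0 n x + 1, fun i hi => ?_⟩
  refine (segRank_add_one_iff hq (Nat.zero_le n) _).1 ?_ i (Nat.zero_le i) hi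
  have h := segRank_iterate_modEq hB hq n (segRank q 0 n x + 1) x
  rw [← add_assoc, add_right_comm] at h
  have h' : segRank q 0 n (B.vershik^[segRank q 0 n x + 1] x) + 1 ≡ 0 [MOD segProd q 0 n] :=
    Nat.ModEq.add_right_cancel' (segRank q 0 n x) (by rwa [zero_add])
  have hdvd := Nat.modEq_zero_iff_dvd.1 h'
  exact le_antisymm (segRank_lt hq (Nat.zero_le n) _) (Nat.le_of_dvd (Nat.succ_pos _) hdvd)

theorem pow_segRank_vershik (hB : B.ProperlyOrdered) (hq : B.IsToeplitz q) {l : ℂ} {n : ℕ}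
    (h : l ^ segProd q 0 n = 1) (x : B.X) :
    l ^ segRank q 0 n (B.vershik x) * l = l ^ segRank q 0 n x := by
  rw [← pow_succ]
  exact pow_eq_pow_of_modEq (segRank_vershik_modEq hB hq n x) h

theorem isContinuousEigenvalue_iff (hB : B.ProperlyOrdered) (hq : B.IsToeplitz q) {b : ℕ}
    (hb : 0 < b) {l : ℂ} (hl : IsPrimitiveRoot l b) :
    IsContinuousEigenvalue B.vershik l ↔ ∃ n, b ∣ segProd q 0 n := by
  obtain ⟨z, hz, hzu⟩ := hB.2
  constructor
  · rintro ⟨f, hfc, hf, hfT⟩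
    have hl1 : ‖l‖ = 1 := hl.norm'_eq_one hb.ne'
    have hiter : ∀ k x, f (B.vershik^[k] x) = l ^ k * f x := by
      intro k x
      induction k generalizing x with
      | zero => simp
      | succ k ih => rw [Function.iterate_succ_apply, ih, hfT, pow_succ, mul_assoc]
    obtain ⟨x, hx⟩ := Function.ne_iff.1 hf
    choose k hk using fun n => exists_iterate_isMin hB hq n x
    have h1 := tendsto_of_isMin hk hzu
    -- T^(p_n) preserves r_n, so these points also begin with n minimal edges and have the same
    -- limit z. Comparing f at the two sequences gives λ^(p_n) → 1.
    have h2 : Tendsto (fun n => B.vershik^[segProd q 0 n] (B.vershik^[k n] x)) atTop (𝓝 z) := by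
      refine tendsto_of_isMin (fun n i hi => ?_) hzu
      refine (segRank_add_one_iff hq (Nat.zero_le n) _).1 ?_ i (Nat.zero_le i) hi
      rw [segRank_iterate_segProd hB hq]
      exact (segRank_add_one_iff hq (Nat.zero_le n) _).2 fun i _ hi => hk n i hi
    -- |f| is constant along the orbit of x, where it is not zero.
    have hfz : f z ≠ 0 := by
      have h3 : Tendsto (fun n => ‖f (B.vershik^[k n] x)‖) atTop (𝓝 ‖f z‖) :=
        ((hfc.tendsto z).comp h1).norm
      simp only [hiter, norm_mul, norm_pow, hl1, one_pow, one_mul] at h3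
      have := tendsto_nhds_unique h3 tendsto_const_nhds
      rw [← norm_ne_zero_iff, this]
      exact norm_ne_zero_iff.2 hx
    have h4 : Tendsto (fun n => l ^ segProd q 0 n) atTop (𝓝 1) := by
      have h5 := ((hfc.tendsto z).comp h2).div ((hfc.tendsto z).comp h1) hfz
      rw [div_self hfz] at h5
      refine h5.congr fun n => ?_
      have hne : f (B.vershik^[k n] x) ≠ 0 := by
        rw [hiter]; exact mul_ne_zero (pow_ne_zero _ (hl.ne_zero hb.ne')) hx
      simp only [Pi.div_apply, Function.comp_apply]
      rw [hiter, mul_div_assoc, div_self hne, mul_one]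
    -- The powers of l form a finite set, so convergence to 1 means being eventually equal to 1.
    have hfin : (Set.range fun n : ℕ => l ^ n).Finite := by
      refine Set.Finite.subset (Finset.finite_toSet ((Finset.range b).image fun i => l ^ i)) ?_
      rintro _ ⟨n, rfl⟩
      rw [Finset.mem_coe, Finset.mem_image]
      exact ⟨n % b, Finset.mem_range.2 (Nat.mod_lt _ hb), by rw [hl.eq_orderOf, pow_mod_orderOf]⟩
    have hev : ∀ᶠ n in atTop, l ^ segProd q 0 n = 1 := by
      have hopen : IsOpen (((Set.range fun n : ℕ => l ^ n) \ {1})ᶜ) :=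
        (hfin.subset Set.sdiff_subset).isClosed.isOpen_compl
      filter_upwards [h4 (hopen.mem_nhds (by simp))] with n hn
      by_contra hne
      exact hn ⟨⟨_, rfl⟩, hne⟩
    obtain ⟨n, hn⟩ := hev.exists
    exact ⟨n, hl.dvd_of_pow_eq_one _ hn⟩
  · rintro ⟨n, hn⟩
    have hpow : (l⁻¹) ^ segProd q 0 n = 1 := by
      rw [inv_pow, (hl.pow_eq_one_iff_dvd _).2 hn, inv_one]
    have hl0 := hl.ne_zero hb.ne'
    refine ⟨fun x => (l⁻¹) ^ segRank q 0 n x, continuous_of_initialPath n fun x y h => by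
      rw [segRank_congr_initialPath h], fun h => ?_, fun x => ?_⟩
    · exact pow_ne_zero _ (inv_ne_zero hl0) (congrFun h z)
    · change _ = l * (l⁻¹) ^ segRank q 0 n x
      rw [← pow_segRank_vershik hB hq hpow x, mul_comm, mul_assoc, inv_mul_cancel₀ hl0, mul_one]

end OrderedBratteliDiagram

/-! ### From an eigenfunction to a cocycle with values in `ZMod b`. -/

section Eigenvalue

variable {X : Type*} [MeasurableSpace X] {T : X → X} {μ : Measure X} {b : ℕ} [NeZero b] {l : ℂ}

theorem pow_val_eq_pow_iff (hl : IsPrimitiveRoot l b) (i : ZMod b) (k : ℕ) :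
    l ^ k = l ^ i.val ↔ (k : ZMod b) = i := by
  have h : ∀ j, l ^ k = l ^ j ↔ k ≡ j [MOD b] := fun j => by
    rw [← pow_mod_orderOf, ← pow_mod_orderOf l j, ← hl.eq_orderOf]
    exact ⟨hl.pow_inj (Nat.mod_lt _ (NeZero.pos b)) (Nat.mod_lt _ (NeZero.pos b)), fun h => by
      rw [show k % b = j % b from h]⟩
  rw [h, ← ZMod.natCast_eq_natCast_iff, ZMod.natCast_zmod_val]

theorem exists_measurable_log (hl : IsPrimitiveRoot l b) :
    ∃ ψ : ℂ → ZMod b, Measurable ψ ∧ ∀ k : ℕ, ψ (l ^ k) = k := by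
  classical
  refine ⟨fun z => ∑ i : ZMod b, if z = l ^ i.val then i else 0, ?_, fun k => ?_⟩
  · exact Finset.measurable_sum _ fun i _ => Measurable.ite
      (measurableSet_singleton (l ^ i.val)) measurable_const measurable_const
  · simp [pow_val_eq_pow_iff hl]

theorem exists_zmod_cocycle_of_eigenvalue (hμ : Ergodic T μ) (hl : IsPrimitiveRoot l b)
    (h : IsMeasurableEigenvalue T μ l) :
    ∃ φ : X → ZMod b, Measurable φ ∧ ∀ᵐ x ∂μ, φ (T x) = φ x + 1 := by
  have hb : b ≠ 0 := NeZero.ne b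
  obtain ⟨f, hf, hf0, hfT⟩ := h
  obtain ⟨ψ, hψ, hψl⟩ := exists_measurable_log hl
  obtain ⟨F, hF, hfF⟩ := hf.1
  have hFT : ∀ᵐ x ∂μ, F (T x) = l * F x := by
    filter_upwards [hfF, hμ.quasiMeasurePreserving.ae hfF, hfT] with x h1 h2 h3
    rw [← h1, ← h2, h3]
  -- F^b is invariant, hence constant; dividing F by a b-th root of this constant makes its values
  -- b-th roots of unity, whose exponents are φ.
  obtain ⟨c, hc⟩ := hμ.quasiErgodic.ae_eq_const_of_ae_eq_comp₀ (g := fun x => F x ^ b)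
    (hF.measurable.pow_const b).nullMeasurable (by
      filter_upwards [hFT] with x hx
      simp only [Function.comp_apply]
      rw [hx, mul_pow, hl.pow_eq_one, one_mul])
  have hc0 : c ≠ 0 := by
    rintro rfl
    apply hf0
    filter_upwards [hfF, hc] with x h1 h2
    rw [h1]
    exact pow_eq_zero_iff hb |>.1 h2
  obtain ⟨w, hw⟩ := IsAlgClosed.exists_pow_nat_eq c (Nat.pos_of_ne_zero hb)
  have hw0 : w ≠ 0 := by rintro rfl; exact hc0 (by rw [← hw, zero_pow hb])
  refine ⟨fun x => ψ (F x / w), hψ.comp (hF.measurable.div_const w), ?_⟩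
  filter_upwards [hFT, hc] with x h1 h2
  have h3 : (F x / w) ^ b = 1 := by
    rw [div_pow, hw]
    exact (congrArg (· / c) h2).trans (div_self hc0)
  obtain ⟨i, -, hi⟩ := hl.eq_pow_of_pow_eq_one h3
  rw [h1, mul_div_assoc, ← hi, ← pow_succ', hψl, hψl, Nat.cast_succ]

end Eigenvalue

/-! ### Approximation of the cocycle by colourings of the towers. -/

namespace OrderedBratteliDiagram

variable {B : OrderedBratteliDiagram} {q : ℕ → ℕ} {μ : Measure B.X} {b : ℕ} [NeZero b]

theorem sum_measure_inter_segRank (hq : B.IsToeplitz q) (n : ℕ) {D : Set B.X}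
    (hD : MeasurableSet D) :
    ∑ r ∈ Finset.range (segProd q 0 n), μ (D ∩ {x | segRank q 0 n x = r}) = μ D := by
  rw [← measure_biUnion_finset]
  · congr 1
    ext x
    simp only [Set.mem_iUnion, Set.mem_inter_iff, Set.mem_ofPred_eq, Finset.mem_range, exists_prop]
    exact ⟨fun ⟨_, _, h, _⟩ => h, fun h => ⟨_, segRank_lt hq (Nat.zero_le n) x, h, rfl⟩⟩
  · intro r _ s _ hrs
    refine Set.disjoint_left.2 fun x hx hx' => hrs ?_
    exact hx.2.symm.trans hx'.2
  · exact fun r _ => hD.inter (measurable_segRank n (measurableSet_singleton r))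

/-- The levels of the towers of a given height have the same trace on a set which is invariant
inside these towers. -/
theorem segProd_mul_measure (hB : B.ProperlyOrdered) (hq : B.IsToeplitz q)
    (hT : MeasurePreserving B.vershik μ μ) (n : ℕ) {D : Set B.X} (hD : MeasurableSet D)
    (hDT : ∀ᵐ x ∂μ, segRank q 0 n (B.vershik x) + 1 = segRank q 0 n x →
      (∀ i, n ≤ i → (B.vershik x).1 i = x.1 i) → (B.vershik x ∈ D ↔ x ∈ D))
    {r : ℕ} (hr : r < segProd q 0 n) :
    segProd q 0 n * μ (D ∩ {x | segRank q 0 n x = r}) = μ D := by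
  have hmeas : ∀ s, MeasurableSet (D ∩ {x | segRank q 0 n x = s}) := fun s =>
    hD.inter (measurable_segRank n (measurableSet_singleton s))
  -- The preimage of row s is row s + 1; the bound on s excludes the wrap-around from row 0 to the
  -- last row.
  have hstep : ∀ s, s + 1 < segProd q 0 n →
      μ (D ∩ {x | segRank q 0 n x = s + 1}) = μ (D ∩ {x | segRank q 0 n x = s}) := by
    intro s hs
    rw [← hT.measure_preimage (hmeas s).nullMeasurableSet]
    refine measure_congr ?_
    filter_upwards [hDT] with x hx
    refine propext ?_
    change (x ∈ D ∧ segRank q 0 n x = s + 1) ↔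
      (B.vershik x ∈ D ∧ segRank q 0 n (B.vershik x) = s)
    rcases segRank_vershik hB hq n x with ⟨h1, h2⟩ | ⟨h1, h2⟩
    · constructor
      · rintro ⟨_, h⟩; omega
      · rintro ⟨_, h⟩; omega
    · rw [hx h1 h2]
      constructor
      · rintro ⟨h, h'⟩; exact ⟨h, by omega⟩
      · rintro ⟨h, h'⟩; exact ⟨h, by omega⟩
  have hall : ∀ s, s < segProd q 0 n →
      μ (D ∩ {x | segRank q 0 n x = s}) = μ (D ∩ {x | segRank q 0 n x = 0}) := by
    intro s
    induction s with
    | zero => exact fun _ => rfl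
    | succ s ih => exact fun hs => (hstep s hs).trans (ih (by omega))
  rw [← sum_measure_inter_segRank hq n hD,
    Finset.sum_congr rfl fun s hs => (hall s (Finset.mem_range.1 hs)).trans (hall r hr).symm,
    Finset.sum_const, Finset.card_range, nsmul_eq_mul]

theorem measurable_add_segRank {φ : B.X → ZMod b} (hφ : Measurable φ) (n : ℕ) :
    Measurable fun x => φ x + (segRank q 0 n x : ZMod b) :=
  (Measurable.of_discrete (f := fun p : ZMod b × ℕ => p.1 + (p.2 : ZMod b))).comp
    (hφ.prodMk (measurable_segRank n))

/-- Choose the row r on which g errs least and read the colours there. The set where the colouring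
fails is invariant inside towers, so its measure is p_n times its trace on row r, which is at most
p_n times the error of g on that row, hence at most the total error of g. -/
theorem exists_tower_coloring_le (hB : B.ProperlyOrdered) (hq : B.IsToeplitz q)
    (hT : MeasurePreserving B.vershik μ μ) {φ : B.X → ZMod b} (hφ : Measurable φ)
    (hφT : ∀ᵐ x ∂μ, φ (B.vershik x) = φ x + 1) (n : ℕ) {g : B.X → ZMod b}
    (hg : ∀ x y : B.X, (∀ i < n, x.1 i = y.1 i) → g x = g y) :
    ∃ ρ : B.V n → ZMod b,
      μ {x | φ x + (segRank q 0 n x : ZMod b) ≠ ρ (B.tau n x)} ≤ μ {x | φ x ≠ g x} := by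
  classical
  obtain ⟨x₀, -⟩ := hB.1
  have hpos := segProd_pos hq x₀ n
  have hgm : MeasurableSet {x | φ x ≠ g x} :=
    (measurableSet_eq_fun hφ (measurable_of_initialPath n hg)).compl
  obtain ⟨r, hr, hmin⟩ := Finset.exists_min_image (Finset.range (segProd q 0 n))
    (fun r => μ ({x | φ x ≠ g x} ∩ {x | segRank q 0 n x = r})) ⟨0, Finset.mem_range.2 hpos⟩
  have hle : segProd q 0 n * μ ({x | φ x ≠ g x} ∩ {x | segRank q 0 n x = r}) ≤
      μ {x | φ x ≠ g x} := by
    rw [← sum_measure_inter_segRank hq n hgm]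
    simpa using Finset.card_nsmul_le_sum _ _ _ hmin
  -- The choice of the point is harmless: the tower and the row determine its first n edges, hence
  -- g.
  let ρ : B.V n → ZMod b := fun t =>
    if h : ∃ x, B.tau n x = t ∧ segRank q 0 n x = r then g h.choose + r else 0
  have hρ : ∀ x, segRank q 0 n x = r → ρ (B.tau n x) = g x + r := by
    intro x hx
    have h : ∃ y, B.tau n y = B.tau n x ∧ segRank q 0 n y = r := ⟨x, rfl, hx⟩
    have h' := h.choose_spec
    change dite _ _ _ = _
    rw [dif_pos h, hg _ x fun i hi =>
      edge_eq_of_tau_eq hq (Nat.zero_le n) h'.1 (h'.2.trans hx.symm) i (Nat.zero_le i) hi]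
  refine ⟨ρ, ?_⟩
  have hρm : Measurable fun x : B.X => ρ (B.tau n x) :=
    measurable_of_initialPath (n + 1) fun x y h => by rw [tau_congr h]
  have hDm : MeasurableSet {x | φ x + (segRank q 0 n x : ZMod b) ≠ ρ (B.tau n x)} :=
    (measurableSet_eq_fun (measurable_add_segRank hφ n) hρm).compl
  rw [← segProd_mul_measure hB hq hT n hDm ?_ (Finset.mem_range.1 hr)]
  · refine le_trans (mul_le_mul_right (measure_mono ?_) _) hle
    rintro x ⟨hx, hxr⟩
    refine ⟨fun h => hx ?_, hxr⟩
    rw [hρ x hxr, h, hxr]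
  · filter_upwards [hφT] with x hx h1 h2
    rw [tau_eq_of_edge_eq h2, hx, ← h1, Nat.cast_succ, add_assoc, add_comm (1 : ZMod b)]

/-- The filtration of the cylinder partitions. -/
def cylinderFiltration (B : OrderedBratteliDiagram) :
    Filtration ℕ (inferInstance : MeasurableSpace B.X) where
  seq n := MeasurableSpace.comap (initialPath n) ⊤
  mono' := by
    rintro m n h s ⟨t, -, rfl⟩
    refine ⟨(fun z (i : Fin m) => z ⟨i, by omega⟩) ⁻¹' t, trivial, rfl⟩
  le' := by
    rintro n s ⟨t, -, rfl⟩
    exact (isOpen_of_initialPath n fun x y h hx => by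
      rwa [Set.mem_preimage, ← initialPath_eq_iff.2 h]).measurableSet

theorem le_iSup_cylinderFiltration (B : OrderedBratteliDiagram) :
    (inferInstance : MeasurableSpace B.X) ≤ ⨆ n, cylinderFiltration B n := by
  let : ∀ i, TopologicalSpace (B.E i) := fun _ => ⊥
  have : ∀ i, DiscreteTopology (B.E i) := fun _ => ⟨rfl⟩
  let : ∀ i, MeasurableSpace (B.E i) := fun _ => ⊤
  have : ∀ i, BorelSpace (B.E i) := fun i => ⟨by rw [borel_eq_top_of_discrete]⟩
  have h1 : (inferInstance : MeasurableSpace B.X) =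
      MeasurableSpace.comap (fun x : B.X => x.1) MeasurableSpace.pi := by
    rw [BorelSpace.measurable_eq (α := ∀ i, B.E i), ← borel_comap]
    rfl
  refine h1.le.trans (measurable_iff_comap_le.1 ?_)
  refine @measurable_pi_lambda _ _ _ (⨆ n, cylinderFiltration B n) _ _ fun i => ?_
  intro s _
  exact le_iSup (fun n => (cylinderFiltration B n : MeasurableSpace B.X)) (i + 1) _
    ⟨{z | z ⟨i, by omega⟩ ∈ s}, trivial, rfl⟩

theorem exists_tower_coloring_tendsto [IsProbabilityMeasure μ] (hB : B.ProperlyOrdered)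
    (hq : B.IsToeplitz q) (hT : MeasurePreserving B.vershik μ μ) {φ : B.X → ZMod b}
    (hφ : Measurable φ) (hφT : ∀ᵐ x ∂μ, φ (B.vershik x) = φ x + 1) :
    ∃ ρ : ∀ n, B.V n → ZMod b,
      Tendsto (fun n => μ {x | φ x + (segRank q 0 n x : ZMod b) ≠ ρ n (B.tau n x)}) atTop (𝓝 0) := by
  let h : B.X → ℝ := fun x => ((φ x).val : ℝ)
  have hm : Measurable h := (Measurable.of_discrete (f := fun i : ZMod b => (i.val : ℝ))).comp hφ
  have hint : Integrable h μ := Integrable.of_bound hm.aestronglyMeasurable (b : ℝ) (by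
    filter_upwards with x
    simp only [h, Real.norm_natCast, Nat.cast_le]
    exact (ZMod.val_lt _).le)
  have hae := hint.tendsto_ae_condExp (ℱ := cylinderFiltration B)
    ((hm.mono (le_iSup_cylinderFiltration B) le_rfl).stronglyMeasurable)
  have hmeas := tendstoInMeasure_of_tendsto_ae (fun n =>
    (stronglyMeasurable_condExp.mono ((cylinderFiltration B).le n)).aestronglyMeasurable) hae
  -- Where the conditional expectation is within less than 1/2 of the integer `(φ x).val`, rounding
  -- recovers φ exactly.
  let g : ℕ → B.X → ZMod b := fun n x => ((round (μ[h|cylinderFiltration B n] x) : ℤ) : ZMod b)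
  have hg : ∀ n x y, (∀ i < n, x.1 i = y.1 i) → g n x = g n y := by
    intro n x y hxy
    have := (stronglyMeasurable_condExp (f := h) (μ := μ)
      (m := cylinderFiltration B n)).factorsThrough (mY := ⊤) (f := initialPath n)
      (initialPath_eq_iff.2 hxy)
    simp only [g, this]
  choose ρ hρ using fun n => exists_tower_coloring_le hB hq hT hφ hφT n (hg n)
  refine ⟨ρ, tendsto_of_tendsto_of_tendsto_of_le_of_le tendsto_const_nhds
    (hmeas (ENNReal.ofReal (1 / 2)) (by simp)) (fun _ => zero_le) fun n =>
      (hρ n).trans (measure_mono fun x hx => ?_)⟩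
  change ENNReal.ofReal (1 / 2) ≤ edist _ _
  rw [edist_dist]
  refine ENNReal.ofReal_le_ofReal ?_
  by_contra hlt
  apply hx
  rw [not_le, Real.dist_eq] at hlt
  have h1 := abs_sub_round (μ[h|cylinderFiltration B n] x)
  have h2 : round (μ[h|cylinderFiltration B n] x) = ((φ x).val : ℤ) := by
    rw [← sub_eq_zero, ← Int.abs_lt_one_iff, ← Int.cast_lt (R := ℝ), Int.cast_abs]
    push_cast
    rw [abs_le] at h1
    rw [abs_lt] at hlt ⊢
    change _ < _ - ((φ x).val : ℝ) ∧ _ - ((φ x).val : ℝ) < _ at hlt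
    constructor <;> linarith [h1.1, h1.2, hlt.1, hlt.2]
  simp only [g, h2, Int.cast_natCast, ZMod.natCast_zmod_val]

end OrderedBratteliDiagram

/-! ### Arithmetic constraints on the colours. -/

namespace OrderedBratteliDiagram

variable {B : OrderedBratteliDiagram} {q : ℕ → ℕ} {μ : Measure B.X} {b : ℕ}

theorem ae_iterate_eq_add (hT : MeasurePreserving B.vershik μ μ) {φ : B.X → ZMod b}
    (hφT : ∀ᵐ x ∂μ, φ (B.vershik x) = φ x + 1) (k : ℕ) :
    ∀ᵐ x ∂μ, φ (B.vershik^[k] x) = φ x + k := by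
  induction k with
  | zero => simp
  | succ k ih =>
    filter_upwards [hT.quasiMeasurePreserving.ae ih, hφT] with x h1 h2
    rw [Function.iterate_succ_apply, h1, h2, Nat.cast_succ, add_assoc, add_comm (1 : ZMod b)]

variable [NeZero b]

/-- T^(p_n) preserves μ and r_n and adds p_n to φ. -/
theorem measure_level_add (hB : B.ProperlyOrdered) (hq : B.IsToeplitz q)
    (hT : MeasurePreserving B.vershik μ μ) {φ : B.X → ZMod b} (hφ : Measurable φ)
    (hφT : ∀ᵐ x ∂μ, φ (B.vershik x) = φ x + 1) (n i : ℕ) (c : ZMod b) :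
    μ {x | φ x + (segRank q 0 n x : ZMod b) = c + i * (segProd q 0 n : ℕ)} =
      μ {x | φ x + (segRank q 0 n x : ZMod b) = c} := by
  induction i with
  | zero => simp
  | succ i ih =>
    rw [← ih, ← (hT.iterate (segProd q 0 n)).measure_preimage (measurableSet_eq_fun
      (measurable_add_segRank hφ n) measurable_const).nullMeasurableSet]
    refine measure_congr ?_
    filter_upwards [ae_iterate_eq_add hT hφT (segProd q 0 n)] with x hx
    refine propext ?_
    change φ (B.vershik^[segProd q 0 n] x) +
      (segRank q 0 n (B.vershik^[segProd q 0 n] x) : ZMod b) = _ ↔ φ x + _ = _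
    rw [hx, segRank_iterate_segProd hB hq, Nat.cast_succ, add_one_mul, ← add_assoc, add_right_comm]
    exact add_left_inj _

theorem natCast_mul_eq_iff {p i j : ℕ} :
    ((p * i : ℕ) : ZMod b) = (p * j : ℕ) ↔ i ≡ j [MOD b / b.gcd p] := by
  rw [ZMod.natCast_eq_natCast_iff]
  refine ⟨Nat.ModEq.cancel_left_div_gcd (Nat.pos_of_ne_zero (NeZero.ne b)), fun h => ?_⟩
  refine (h.mul_left' p).of_dvd ?_
  obtain ⟨e, he⟩ := Nat.gcd_dvd_right b p
  refine ⟨e, ?_⟩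
  nth_rewrite 1 [he]
  rw [mul_right_comm, Nat.mul_div_cancel' (Nat.gcd_dvd_left b p)]

/-- Some value c of φ + r_n has measure at least 1/b, and so do all the values c + i p_n. The
exceptional set is smaller than 1/b, so each of these b / gcd(b, p_n) values is the colour of some
label. -/
theorem div_gcd_le_of_coloring [IsProbabilityMeasure μ] (hB : B.ProperlyOrdered)
    (hq : B.IsToeplitz q) (hT : MeasurePreserving B.vershik μ μ) {φ : B.X → ZMod b}
    (hφ : Measurable φ) (hφT : ∀ᵐ x ∂μ, φ (B.vershik x) = φ x + 1) {n d : ℕ} (σ : B.X → Fin d)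
    (ρ : Fin d → ZMod b)
    (hρ : b * μ {x | φ x + (segRank q 0 n x : ZMod b) ≠ ρ (σ x)} < 1) :
    b / b.gcd (segProd q 0 n) ≤ d := by
  classical
  obtain ⟨c, -, hc⟩ := Finset.exists_max_image (Finset.univ : Finset (ZMod b))
    (fun c => μ {x | φ x + (segRank q 0 n x : ZMod b) = c}) Finset.univ_nonempty
  have hsum : ∑ c : ZMod b, μ {x | φ x + (segRank q 0 n x : ZMod b) = c} = 1 := by
    rw [← measure_univ (μ := μ), ← measure_biUnion_finset]
    · congr 1
      ext x
      simp
    · intro r _ s _ hrs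
      refine Set.disjoint_left.2 fun x hx hx' => hrs ?_
      exact Eq.trans (Eq.symm hx) hx'
    · exact fun r _ => measurableSet_eq_fun (measurable_add_segRank hφ n) measurable_const
  have hle : 1 ≤ b * μ {x | φ x + (segRank q 0 n x : ZMod b) = c} := by
    rw [← hsum]
    simpa [ZMod.card] using Finset.sum_le_card_nsmul _ _ _ hc
  have hmem : ∀ i : Fin (b / b.gcd (segProd q 0 n)),
      ∃ t : Fin d, ρ t = c + (segProd q 0 n * i.1 : ℕ) := by
    intro i
    by_contra hne
    push Not at hne
    refine absurd (hle.trans ?_) hρ.not_ge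
    rw [← measure_level_add hB hq hT hφ hφT n i c]
    refine mul_le_mul_right (measure_mono fun x hx => ?_) _
    have hx' : φ x + (segRank q 0 n x : ZMod b) = c + i.1 * (segProd q 0 n : ℕ) := hx
    change φ x + (segRank q 0 n x : ZMod b) ≠ ρ (σ x)
    rw [hx', ← Nat.cast_mul, mul_comm]
    exact (hne (σ x)).symm
  choose t ht using hmem
  have hinj : Function.Injective t := by
    intro i j hij
    have := (ht i).symm.trans ((congrArg ρ hij).trans (ht j))
    exact Fin.ext ((natCast_mul_eq_iff.1 (add_left_cancel this)).eq_of_lt_of_lt i.2 j.2)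
  simpa using Fintype.card_le_of_injective t hinj

/-- Modulo a divisor g of p_n, the change of r_n under T is -1 even at the wrap-around, and it
cancels that of φ; ergodicity does the rest. -/
theorem exists_ae_castHom_eq (hB : B.ProperlyOrdered) (hq : B.IsToeplitz q)
    (hμ : Ergodic B.vershik μ) {φ : B.X → ZMod b} (hφ : Measurable φ)
    (hφT : ∀ᵐ x ∂μ, φ (B.vershik x) = φ x + 1) {n g : ℕ} (hgb : g ∣ b)
    (hg : g ∣ segProd q 0 n) :
    ∃ c : ZMod g, ∀ᵐ x ∂μ,
      ZMod.castHom hgb (ZMod g) (φ x + (segRank q 0 n x : ZMod b)) = c := by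
  have : NeZero g := ⟨ne_zero_of_dvd_ne_zero (NeZero.ne b) hgb⟩
  refine hμ.quasiErgodic.ae_eq_const_of_ae_eq_comp₀ (g := fun x =>
    ZMod.castHom hgb (ZMod g) (φ x + (segRank q 0 n x : ZMod b)))
    (Measurable.comp (g := ZMod.castHom hgb (ZMod g)) Measurable.of_discrete
      (measurable_add_segRank hφ n)).nullMeasurable ?_
  filter_upwards [hφT] with x hx
  have h := (ZMod.natCast_eq_natCast_iff _ _ _).2
    ((segRank_vershik_modEq hB hq n x).of_dvd hg)
  simp only [Function.comp_apply, hx, map_add, map_one, map_natCast]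
  rw [← h, Nat.cast_succ, add_assoc, add_comm (1 : ZMod g)]

theorem exists_natCast_mul_eq {p : ℕ} {u v : ZMod b}
    (h : ZMod.castHom (Nat.gcd_dvd_left b p) (ZMod (b.gcd p)) u =
      ZMod.castHom (Nat.gcd_dvd_left b p) (ZMod (b.gcd p)) v) :
    ∃ k < b / b.gcd p, ((p * k : ℕ) : ZMod b) = v - u := by
  have hb : 0 < b := Nat.pos_of_ne_zero (NeZero.ne b)
  have hg : 0 < b.gcd p := Nat.gcd_pos_of_pos_left _ hb
  have h0 : ((v - u).val : ZMod (b.gcd p)) = 0 := by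
    rw [← map_natCast (ZMod.castHom (Nat.gcd_dvd_left b p) (ZMod (b.gcd p))),
      ZMod.natCast_zmod_val, map_sub, h, sub_self]
  obtain ⟨w, hw⟩ := (ZMod.natCast_eq_zero_iff _ _).1 h0
  obtain ⟨m, hm⟩ : ∃ m : ℕ, ((p * m : ℕ) : ZMod b) = v - u := by
    -- v - u is w times the gcd, and by Bézout the gcd is p times `b.gcdB p` modulo b.
    refine ⟨((b.gcdB p * w : ℤ) : ZMod b).val, ?_⟩
    rw [Nat.cast_mul, ZMod.natCast_zmod_val, ← ZMod.natCast_zmod_val (v - u), hw, Nat.cast_mul,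
      ← Int.cast_natCast (b.gcd p), Nat.gcd_eq_gcd_ab]
    push_cast
    simp [mul_assoc]
  refine ⟨m % (b / b.gcd p), Nat.mod_lt _ (Nat.div_pos (Nat.gcd_le_left _ hb) hg), ?_⟩
  rw [← hm, natCast_mul_eq_iff]
  exact Nat.mod_modEq _ _

end OrderedBratteliDiagram

theorem isPrimitiveRoot_exp_of_isCoprime {a : ℤ} {b : ℕ} (hb : 0 < b)
    (hab : IsCoprime a (b : ℤ)) :
    IsPrimitiveRoot (Complex.exp (2 * Real.pi * Complex.I * (a / b))) b := by
  have h := (Complex.isPrimitiveRoot_exp b hb.ne').zpow_of_gcd_eq_one a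
    (Int.isCoprime_iff_gcd_eq_one.1 hab)
  rw [← Complex.exp_int_mul] at h
  rwa [show (2 * Real.pi * Complex.I * (a / b) : ℂ) = a * (2 * Real.pi * Complex.I / b) by ring]

/-! ### From a colouring to an eigenfunction. -/

namespace OrderedBratteliDiagram

variable {B : OrderedBratteliDiagram} {q : ℕ → ℕ} {d : ℕ} {lab : ∀ n, B.V n → Fin d}
  {μ : Measure B.X} {b : ℕ}

theorem tendsto_measure_lab_notMem [IsProbabilityMeasure μ] {J : Set (Fin d)}
    (h : ∀ t ∉ J, Tendsto (fun n => μ.real {x | lab n (B.tau n x) = t}) atTop (𝓝 0)) :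
    Tendsto (fun n => μ {x | lab n (B.tau n x) ∉ J}) atTop (𝓝 0) := by
  classical
  have h' : ∀ t ∈ Finset.univ.filter (· ∉ J),
      Tendsto (fun n => μ {x | lab n (B.tau n x) = t}) atTop (𝓝 0) := by
    intro t ht
    rw [← ENNReal.tendsto_toReal_iff (fun _ => measure_ne_top _ _) ENNReal.zero_ne_top]
    exact h t (Finset.mem_filter.1 ht).2
  have hsum := tendsto_finsetSum _ h'
  rw [Finset.sum_const_zero] at hsum
  refine tendsto_of_tendsto_of_tendsto_of_le_of_le tendsto_const_nhds hsum (fun _ => zero_le)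
    fun n => le_trans (measure_mono fun x hx => ?_) (measure_biUnion_finset_le _ _)
  simp only [Set.mem_iUnion]
  exact ⟨_, Finset.mem_filter.2 ⟨Finset.mem_univ _, hx⟩, rfl⟩

/-- Each of the d vertices of level n sends an edge to the given vertex. -/
theorem two_le_of_isProper (hproper : B.IsProper d lab) (hq : B.IsToeplitz q) (hd : 2 ≤ d)
    (x : B.X) {n : ℕ} (hn : 1 ≤ n) : 2 ≤ q (n + 1) := by
  have h : ∀ v : B.V n, ∃ e : B.E n, B.src e = v ∧ B.tgt e = B.tgt (x.1 n) := fun v => by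
    obtain ⟨⟨e, he⟩⟩ := (Nat.card_pos_iff.1 (hproper.pos n hn v (B.tgt (x.1 n)))).1
    exact ⟨e, he⟩
  choose e he using h
  rw [← hq n (B.tgt (x.1 n))]
  have hcard : Nat.card (B.V n) = d := by
    rw [Nat.card_congr (Equiv.ofBijective _ (hproper.lab_bijective n hn)), Nat.card_eq_fintype_card,
      Fintype.card_fin]
  refine le_trans (hd.trans_eq hcard.symm) (Nat.card_le_card_of_injective
    (fun v => (⟨e v, (he v).2⟩ : {e : B.E n // B.tgt e = B.tgt (x.1 n)})) fun v w hvw => ?_)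
  rw [← (he v).1, ← (he w).1]
  exact congrArg B.src (congrArg Subtype.val hvw)

theorem le_segProd (hproper : B.IsProper d lab) (hq : B.IsToeplitz q) (hd : 2 ≤ d) (x : B.X)
    (n : ℕ) : n ≤ segProd q 0 n := by
  induction n with
  | zero => exact Nat.zero_le _
  | succ n ih =>
    have h1 := segProd_pos hq x n
    have h2 := segProd_pos hq x (n + 1)
    rcases Nat.eq_zero_or_pos n with rfl | hn
    · exact h2
    · rw [segProd_succ (Nat.zero_le n)]
      have := Nat.mul_le_mul_left (segProd q 0 n) (two_le_of_isProper hproper hq hd x hn)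
      omega

/-- The row r_n = 0 has measure 1/p_n, and p_n ≥ n because d ≥ 2. Thus almost every orbit step
eventually stays inside a tower. -/
theorem ae_exists_segRank_ne_zero [IsProbabilityMeasure μ] (hproper : B.IsProper d lab)
    (hq : B.IsToeplitz q) (hd : 2 ≤ d) (hT : MeasurePreserving B.vershik μ μ) :
    ∀ᵐ x ∂μ, ∃ n, segRank q 0 n x ≠ 0 := by
  obtain ⟨x₀, -⟩ := hproper.properlyOrdered.1
  have hle : ∀ n : ℕ, n * μ {x : B.X | ¬ ∃ n, segRank q 0 n x ≠ 0} ≤ 1 := by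
    intro n
    have h := segProd_mul_measure hproper.properlyOrdered hq hT n MeasurableSet.univ
      (Eventually.of_forall fun _ _ _ => Iff.rfl) (segProd_pos hq x₀ n)
    rw [measure_univ] at h
    rw [← h]
    refine mul_le_mul' (Nat.cast_le.2 (le_segProd hproper hq hd x₀ n)) (measure_mono fun x hx => ?_)
    exact ⟨trivial, by_contra fun h => hx ⟨n, h⟩⟩
  rw [ae_iff]
  by_contra hne
  obtain ⟨n, hn⟩ := ENNReal.exists_nat_mul_gt hne ENNReal.one_ne_top
  exact (hle n).not_gt hn

/-- Inside the towers of a high level, the Vershik map decreases the rank by one. -/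
theorem ae_eventually_segRank_vershik [IsProbabilityMeasure μ] (hproper : B.IsProper d lab)
    (hq : B.IsToeplitz q) (hd : 2 ≤ d) (hT : MeasurePreserving B.vershik μ μ) :
    ∀ᵐ x ∂μ, ∀ᶠ n in atTop, segRank q 0 n (B.vershik x) + 1 = segRank q 0 n x ∧
      B.tau n (B.vershik x) = B.tau n x := by
  filter_upwards [ae_exists_segRank_ne_zero hproper hq hd hT] with x ⟨n, hn⟩
  filter_upwards [eventually_ge_atTop n] with m hm
  rcases segRank_vershik hproper.properlyOrdered hq m x with ⟨h, -⟩ | ⟨h1, h2⟩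
  · rw [segRank_add (Nat.zero_le n) hm] at h
    omega
  · exact ⟨h1, tau_eq_of_edge_eq h2⟩

theorem isMeasurableEigenvalue_of_coloring [IsProbabilityMeasure μ] (hproper : B.IsProper d lab)
    (hq : B.IsToeplitz q) (hd : 2 ≤ d) (hT : MeasurePreserving B.vershik μ μ) (hb : b ≠ 0)
    {l : ℂ} (hl : IsPrimitiveRoot l b) {ν : ℕ → ℕ} (hν : StrictMono ν) (ρ : Fin d → ℕ)
    (h : ∀ᵐ x ∂μ, ∀ᶠ n in atTop, segProd q 0 (ν n) * segRank q (ν n) (ν (n + 1)) x +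
      ρ (lab (ν n) (B.tau (ν n) x)) ≡ ρ (lab (ν (n + 1)) (B.tau (ν (n + 1)) x)) [MOD b]) :
    IsMeasurableEigenvalue B.vershik μ l := by
  have hl0 := hl.ne_zero hb
  have hl1 : ‖l‖ = 1 := hl.norm'_eq_one hb
  -- The congruence hypothesis says precisely that F n x = F (n + 1) x for large n; modulus one
  -- keeps the limit non zero.
  let F : ℕ → B.X → ℂ := fun n x =>
    l⁻¹ ^ segRank q 0 (ν n) x * l ^ ρ (lab (ν n) (B.tau (ν n) x))
  have hF1 : ∀ n x, ‖F n x‖ = 1 := fun n x => by simp [F, hl1]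
  have hFm : ∀ n, Measurable (F n) := fun n =>
    measurable_of_initialPath (ν n + 1) fun x y hxy => by
      simp only [F]
      rw [tau_congr hxy, segRank_congr_initialPath fun i hi => hxy i (by omega)]
  have hlim : ∀ᵐ x ∂μ, ∃ z, Tendsto (fun n => F n x) atTop (𝓝 z) := by
    filter_upwards [h] with x hx
    obtain ⟨N, hN⟩ := eventually_atTop.1 hx
    refine ⟨F N x, tendsto_atTop_of_eventually_const (i₀ := N) fun n hn => ?_⟩
    induction n, hn using Nat.le_induction with
    | base => rfl
    | succ n hn ih =>
      rw [← ih]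
      have h1 := pow_eq_pow_of_modEq (hN n hn) hl.pow_eq_one
      simp only [F]
      rw [segRank_add (Nat.zero_le _) (hν (Nat.lt_succ_self n)).le, ← h1, pow_add, pow_add,
        inv_pow, inv_pow]
      have h2 : l ^ (segProd q 0 (ν n) * segRank q (ν n) (ν (n + 1)) x) ≠ 0 := pow_ne_zero _ hl0
      field_simp
  obtain ⟨f, hfm, hf⟩ := measurable_limit_of_tendsto_metrizable_ae
    (fun n => (hFm n).aemeasurable) hlim
  have hf1 : ∀ᵐ x ∂μ, ‖f x‖ = 1 := by
    filter_upwards [hf] with x hx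
    refine tendsto_nhds_unique hx.norm ?_
    simp only [hF1]
    exact tendsto_const_nhds
  refine ⟨f, MemLp.of_bound hfm.aestronglyMeasurable 1 (hf1.mono fun x hx => hx.le), ?_, ?_⟩
  · intro h0
    obtain ⟨x, hx, hx'⟩ := (h0.and hf1).exists
    rw [hx] at hx'
    simp at hx'
  · filter_upwards [hf, hT.quasiMeasurePreserving.ae hf,
      ae_eventually_segRank_vershik hproper hq hd hT] with x h1 h2 h3
    refine tendsto_nhds_unique h2 ((h1.const_mul l).congr' ?_)
    filter_upwards [hν.tendsto_atTop.eventually h3] with n hn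
    simp only [F]
    rw [hn.2, ← hn.1, pow_succ]
    field_simp

end OrderedBratteliDiagram

/-! ### The telescoping criterion for measurable eigenvalues. -/

namespace OrderedBratteliDiagram

variable {B : OrderedBratteliDiagram} {q : ℕ → ℕ} {d : ℕ} {lab : ∀ n, B.V n → Fin d}
  {μ : Measure B.X} {b : ℕ}

/-- Along a suitable subsequence of levels, a measurable cocycle with values in `ZMod b` is given
by a fixed coloring of the towers, up to sets of summable measures. -/
theorem exists_subsequence_coloring [NeZero b] [IsProbabilityMeasure μ] {J : Set (Fin d)}
    (hproper : B.IsProper d lab) (hq : B.IsToeplitz q) (hT : MeasurePreserving B.vershik μ μ)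
    (hJ : ∀ t ∉ J, Tendsto (fun n => μ.real {x | lab n (B.tau n x) = t}) atTop (𝓝 0))
    {φ : B.X → ZMod b} (hφ : Measurable φ) (hφT : ∀ᵐ x ∂μ, φ (B.vershik x) = φ x + 1)
    {ε : ℕ → ENNReal} (hε : ∀ n, 0 < ε n) :
    ∃ θ : ℕ → ℕ, StrictMono θ ∧ ∃ (ρ : Fin d → ZMod b) (p : ZMod b), ∀ j, 1 ≤ θ j ∧
      ((segProd q 0 (θ j) : ℕ) : ZMod b) = p ∧
      μ {x | φ x + (segRank q 0 (θ j) x : ZMod b) ≠ ρ (lab (θ j) (B.tau (θ j) x))} < ε j ∧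
      μ {x | lab (θ j) (B.tau (θ j) x) ∉ J} < ε j := by
  obtain ⟨ρ, hρ⟩ := exists_tower_coloring_tendsto hproper.properlyOrdered hq hT hφ hφT
  -- The colourings are moved to the common label set so that they can coincide at different levels;
  -- the default 0 never matters when n ≥ 1, as `lab n` is then bijective.
  let col : ℕ → Fin d → ZMod b := fun n => Function.extend (lab n) (ρ n) 0
  have hcol : ∀ n, 1 ≤ n → ∀ v, col n (lab n v) = ρ n v := fun n hn v =>
    (hproper.lab_bijective n hn).1.extend_apply _ _ _
  have hlab := tendsto_measure_lab_notMem hJ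
  obtain ⟨⟨ρ₀, p⟩, hfib⟩ := Finite.exists_infinite_fiber
    (fun n => (col n, ((segProd q 0 n : ℕ) : ZMod b)))
  have hfreq := Nat.frequently_atTop_iff_infinite.2 (Set.infinite_coe_iff.1 hfib)
  obtain ⟨θ, hθ, hP⟩ := extraction_forall_of_frequently (P := fun j n => 1 ≤ n ∧
      ((segProd q 0 n : ℕ) : ZMod b) = p ∧
      μ {x | φ x + (segRank q 0 n x : ZMod b) ≠ ρ₀ (lab n (B.tau n x))} < ε j ∧
      μ {x | lab n (B.tau n x) ∉ J} < ε j) fun j => by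
    refine (hfreq.and_eventually ((eventually_ge_atTop 1).and
      ((hρ.eventually_lt_const (hε j)).and (hlab.eventually_lt_const (hε j))))).mono ?_
    rintro n ⟨hn, h1, h2, h3⟩
    obtain ⟨hn1, hn2⟩ := Prod.ext_iff.1 hn
    refine ⟨h1, hn2, ?_, h3⟩
    have hn1' : col n = ρ₀ := hn1
    rw [← hn1']
    simpa only [hcol n h1] using h2
  exact ⟨θ, hθ, ρ₀, p, hP⟩

theorem div_gcd_eq_of_modEq {m p : ℕ} (h : m ≡ p [MOD b]) : b / b.gcd m = b / b.gcd p := by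
  rw [Nat.gcd_comm b m, Nat.gcd_comm b p, Nat.ModEq.gcd_eq h]

theorem one_lt_div_gcd (hb : 0 < b) {p : ℕ} (h : ¬ b ∣ p) : 1 < b / b.gcd p := by
  by_contra hle
  have h1 := Nat.mul_div_cancel' (Nat.gcd_dvd_left b p)
  have h2 : b / b.gcd p = 1 :=
    le_antisymm (not_lt.1 hle) (Nat.div_pos (Nat.gcd_le_left _ hb) (Nat.gcd_pos_of_pos_left _ hb))
  rw [h2, mul_one] at h1
  exact h (h1 ▸ Nat.gcd_dvd_right b p)

theorem exists_telescoping_of_eigenvalue [IsProbabilityMeasure μ] {J : Set (Fin d)}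
    (hproper : B.IsProper d lab) (hq : B.IsToeplitz q) (hμ : Ergodic B.vershik μ) {δ : ℝ}
    (hδ : 0 < δ) (hδJ : ∀ t ∈ J, ∀ n, 1 ≤ n → δ ≤ μ.real {x | lab n (B.tau n x) = t})
    (hJ : ∀ t ∉ J, Tendsto (fun n => μ.real {x | lab n (B.tau n x) = t}) atTop (𝓝 0))
    (hb : 0 < b) {l : ℂ} (hl : IsPrimitiveRoot l b)
    (hev : IsMeasurableEigenvalue B.vershik μ l) (hdvd : ∀ n, ¬ b ∣ segProd q 0 n) :
    ∃ ν : ℕ → ℕ, IsTelescoping ν ∧ ∃ p bb : ℕ, ∃ k : Fin d → Fin d → ℕ,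
      (p < b ∧ ∀ n, 2 ≤ n → pSeq q (ν n) ≡ p [MOD b]) ∧
      (1 < bb ∧ bb ≤ d ∧ ∀ᶠ n in atTop, b / Nat.gcd b (pSeq q (ν n)) = bb) ∧
      ((∀ t₁ t₂, k t₁ t₂ < bb) ∧
        ∀ t₁ ∈ J, ∀ t₂ ∈ J, ∀ t₃ ∈ J,
          p * k t₁ t₃ ≡ p * k t₁ t₂ + p * k t₂ t₃ [MOD b] ∧
          p * k t₁ t₁ ≡ 0 [MOD b] ∧
          (p * k t₁ t₂ : ℤ) ≡ -(p * k t₂ t₁ : ℤ) [ZMOD b]) ∧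
      (∀ᵐ x ∂μ, ∀ᶠ n in atTop,
        lab (ν n) (B.tau (ν n) x) ∈ J ∧
        B.suffixCount (ν n) (ν (n + 1)) x ≡
          k (lab (ν n) (B.tau (ν n) x)) (lab (ν (n + 1)) (B.tau (ν (n + 1)) x)) [MOD bb]) := by
  have : NeZero b := ⟨hb.ne'⟩
  have hB := hproper.properlyOrdered
  have hT := hμ.toMeasurePreserving
  obtain ⟨φ, hφ, hφT⟩ := exists_zmod_cocycle_of_eigenvalue hμ hl hev
  have hb' : (b : ENNReal) ≠ 0 := Nat.cast_ne_zero.2 hb.ne'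
  have hε₀ : 0 < min (ENNReal.ofReal δ) ((b : ENNReal)⁻¹) :=
    lt_min (ENNReal.ofReal_pos.2 hδ) (ENNReal.inv_pos.2 (ENNReal.natCast_ne_top b))
  obtain ⟨ε', hε', hsum⟩ := ENNReal.exists_pos_sum_of_countable' one_ne_zero ℕ
  -- The three bounds on the errors serve Borel–Cantelli (summability), the colours on J (δ), and
  -- the inequality b / gcd(b, p) ≤ d (1/b).
  obtain ⟨θ, hθ, ρ, p', hP⟩ := exists_subsequence_coloring hproper hq hT hJ hφ hφT
    (ε := fun n => min (ε' n) (min (ENNReal.ofReal δ) ((b : ENNReal)⁻¹)))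
    fun n => lt_min (hε' n) hε₀
  obtain ⟨p, hpb, rfl⟩ : ∃ p < b, (p : ZMod b) = p' :=
    ⟨p'.val, ZMod.val_lt _, ZMod.natCast_zmod_val _⟩
  have hmod : ∀ j, segProd q 0 (θ j) ≡ p [MOD b] := fun j =>
    (ZMod.natCast_eq_natCast_iff _ _ _).1 (hP j).2.1
  have hbad : μ {x | φ x + (segRank q 0 (θ 0) x : ZMod b) ≠ ρ (lab (θ 0) (B.tau (θ 0) x))} <
      min (ENNReal.ofReal δ) ((b : ENNReal)⁻¹) :=
    (hP 0).2.2.1.trans_le (min_le_right _ _)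
  have hbd : b / b.gcd p ≤ d := by
    rw [← div_gcd_eq_of_modEq (hmod 0)]
    refine div_gcd_le_of_coloring hB hq hT hφ hφT (fun x => lab (θ 0) (B.tau (θ 0) x)) ρ ?_
    have := ENNReal.mul_lt_mul_right hb' (ENNReal.natCast_ne_top b)
      (hbad.trans_le (min_le_right _ _))
    rwa [ENNReal.mul_inv_cancel hb' (ENNReal.natCast_ne_top b)] at this
  have hgdvd : b.gcd p ∣ segProd q 0 (θ 0) := by
    rw [Nat.gcd_comm, ← Nat.ModEq.gcd_eq (hmod 0)]
    exact Nat.gcd_dvd_left _ _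
  obtain ⟨c, hc⟩ := exists_ae_castHom_eq hB hq hμ hφ hφT (Nat.gcd_dvd_left b p) hgdvd
  -- A tower with label in J has measure at least δ, too large to lie in the exceptional set, so its
  -- colour has the almost sure residue c.
  have hρc : ∀ t ∈ J, ZMod.castHom (Nat.gcd_dvd_left b p) (ZMod (b.gcd p)) (ρ t) = c := by
    intro t ht
    by_contra hne
    have hle : μ {x | lab (θ 0) (B.tau (θ 0) x) = t} ≤
        μ {x | φ x + (segRank q 0 (θ 0) x : ZMod b) ≠ ρ (lab (θ 0) (B.tau (θ 0) x))} := by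
      refine measure_mono_ae ?_
      filter_upwards [hc] with x hx hxt heq
      rw [heq] at hx
      exact hne ((congrArg _ (congrArg ρ (Eq.symm hxt))).trans hx)
    have h1 := hδJ t ht (θ 0) (hP 0).1
    rw [measureReal_def, ← ENNReal.ofReal_le_iff_le_toReal (measure_ne_top _ _)] at h1
    exact ((h1.trans hle).trans_lt (hbad.trans_le (min_le_left _ _))).false
  have hk : ∀ t₁ t₂, ∃ k < b / b.gcd p, t₁ ∈ J → t₂ ∈ J →
      ((p * k : ℕ) : ZMod b) = ρ t₂ - ρ t₁ := by
    intro t₁ t₂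
    by_cases h : t₁ ∈ J ∧ t₂ ∈ J
    · obtain ⟨k, hk, hk'⟩ := exists_natCast_mul_eq ((hρc t₁ h.1).trans (hρc t₂ h.2).symm)
      exact ⟨k, hk, fun _ _ => hk'⟩
    · exact ⟨0, Nat.div_pos (Nat.gcd_le_left _ hb) (Nat.gcd_pos_of_pos_left _ hb),
        fun h1 h2 => absurd ⟨h1, h2⟩ h⟩
  choose k hkb hk using hk
  have hνθ : ∀ n, 1 ≤ n → (if n = 0 then 0 else θ n) = θ n := fun n hn => if_neg (by omega)
  -- A telescoping must start at level 0, so θ 0 is dropped; all the requirements concern later or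
  -- large indices.
  refine ⟨fun n => if n = 0 then 0 else θ n, ⟨fun i j hij => ?_, if_pos rfl⟩, p, b / b.gcd p, k,
    ⟨hpb, fun n hn => ?_⟩, ⟨?_, hbd, ?_⟩, ⟨hkb, fun t₁ h₁ t₂ h₂ t₃ h₃ => ⟨?_, ?_, ?_⟩⟩, ?_⟩
  · beta_reduce
    rw [hνθ j (by omega)]
    split_ifs with hi
    · exact (hP j).1
    · exact hθ hij
  · beta_reduce
    rw [hνθ n (by omega), pSeq_eq_segProd]
    exact hmod n
  · rw [← div_gcd_eq_of_modEq (hmod 0)]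
    exact one_lt_div_gcd hb (hdvd _)
  · filter_upwards [eventually_ge_atTop 1] with n hn
    rw [hνθ n hn, pSeq_eq_segProd]
    exact div_gcd_eq_of_modEq (hmod n)
  · rw [← ZMod.natCast_eq_natCast_iff, Nat.cast_add, hk _ _ h₁ h₃, hk _ _ h₁ h₂, hk _ _ h₂ h₃]
    ring
  · rw [← ZMod.natCast_eq_natCast_iff, hk _ _ h₁ h₁, sub_self, Nat.cast_zero]
  · rw [← ZMod.intCast_eq_intCast_iff, Int.cast_neg]
    have h12 := hk _ _ h₁ h₂
    have h21 := hk _ _ h₂ h₁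
    push_cast at h12 h21 ⊢
    rw [h12, h21, neg_sub]
  · have hs : ∀ s : ℕ → Set B.X, (∀ j, μ (s j) < min (ε' j) (min (ENNReal.ofReal δ) (b : ENNReal)⁻¹))
        → ∀ᵐ x ∂μ, ∀ᶠ n in atTop, x ∉ s n := fun s hs =>
      ae_eventually_notMem ((ENNReal.tsum_le_tsum fun j =>
        ((hs j).le.trans (min_le_left _ _))).trans_lt (hsum.trans ENNReal.one_lt_top)).ne
    filter_upwards [hs _ fun j => (hP j).2.2.1, hs _ fun j => (hP j).2.2.2] with x h1 h2
    have h1' : ∀ᶠ n in atTop,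
        φ x + (segRank q 0 (θ n) x : ZMod b) = ρ (lab (θ n) (B.tau (θ n) x)) :=
      h1.mono fun n hn => not_not.1 hn
    have h2' : ∀ᶠ n in atTop, lab (θ n) (B.tau (θ n) x) ∈ J := h2.mono fun n hn => not_not.1 hn
    filter_upwards [h1', h2', (tendsto_add_atTop_nat 1).eventually h1',
      (tendsto_add_atTop_nat 1).eventually h2', eventually_ge_atTop 1] with n ha hJn ha' hJn' hn
    rw [hνθ n hn, hνθ (n + 1) (by omega)]
    have hle := (hθ (Nat.lt_succ_self n)).le
    refine ⟨hJn, ?_⟩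
    -- Subtracting the formulas for φ at two consecutive levels leaves p_n s̄ = ρ(τ') - ρ(τ) modulo
    -- b; cancelling p turns this into a congruence modulo b / gcd(b, p).
    rw [suffixCount_eq_segRank hq hle, ← natCast_mul_eq_iff, hk _ _ hJn hJn', ← ha, ← ha',
      segRank_add (Nat.zero_le _) hle, Nat.cast_add, Nat.cast_mul, Nat.cast_mul, (hP n).2.1]
    ring

theorem isMeasurableEigenvalue_of_telescoping [IsProbabilityMeasure μ] {J : Set (Fin d)}
    (hproper : B.IsProper d lab) (hq : B.IsToeplitz q) (hT : MeasurePreserving B.vershik μ μ)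
    (hb : 0 < b) {l : ℂ} (hl : IsPrimitiveRoot l b) {ν : ℕ → ℕ} (hν : StrictMono ν) {p bb : ℕ}
    {k : Fin d → Fin d → ℕ} (hp : ∀ n, 2 ≤ n → pSeq q (ν n) ≡ p [MOD b]) (hbb : 1 < bb)
    (hbd : bb ≤ d) (hgcd : ∀ᶠ n in atTop, b / Nat.gcd b (pSeq q (ν n)) = bb)
    (hk : ∀ t₁ ∈ J, ∀ t₂ ∈ J, ∀ t₃ ∈ J, p * k t₁ t₃ ≡ p * k t₁ t₂ + p * k t₂ t₃ [MOD b])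
    (hs : ∀ᵐ x ∂μ, ∀ᶠ n in atTop,
        lab (ν n) (B.tau (ν n) x) ∈ J ∧
        B.suffixCount (ν n) (ν (n + 1)) x ≡
          k (lab (ν n) (B.tau (ν n) x)) (lab (ν (n + 1)) (B.tau (ν (n + 1)) x)) [MOD bb]) :
    IsMeasurableEigenvalue B.vershik μ l := by
  have : NeZero b := ⟨hb.ne'⟩
  have hbp : b / b.gcd p = bb := by
    obtain ⟨n, hn, hn2⟩ := (hgcd.and (eventually_ge_atTop 2)).exists
    rw [← hn, div_gcd_eq_of_modEq (hp n hn2)]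
  -- Any label in J can be the base point of the colouring; an almost sure path supplies one. The
  -- cocycle relation for k then gives the congruence between levels.
  obtain ⟨x₀, hx₀⟩ := hs.exists
  obtain ⟨n₀, hn₀, -⟩ := hx₀.exists
  refine isMeasurableEigenvalue_of_coloring hproper hq (by omega) hT hb.ne' hl hν
    (fun t => p * k (lab (ν n₀) (B.tau (ν n₀) x₀)) t) ?_
  filter_upwards [hs] with x hx
  filter_upwards [hx, (tendsto_add_atTop_nat 1).eventually hx, eventually_ge_atTop 2]
    with n h1 h2 hn
  have hle := (hν (Nat.lt_succ_self n)).le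
  have h3 := h1.2
  rw [suffixCount_eq_segRank hq hle, ← hbp, ← natCast_mul_eq_iff,
    ZMod.natCast_eq_natCast_iff] at h3
  have h4 := hp n hn
  rw [pSeq_eq_segProd] at h4
  have h5 := (((h4.mul_right (segRank q (ν n) (ν (n + 1)) x)).trans h3).add_right
    (p * k (lab (ν n₀) (B.tau (ν n₀) x₀)) (lab (ν n) (B.tau (ν n) x))))
  rw [add_comm (p * k (lab (ν n) _) _)] at h5
  exact h5.trans (hk _ hn₀ _ h1.1 _ h2.1).symm

end OrderedBratteliDiagram

/-! ### The main theorem. -/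

theorem mainTheorem2 (B : OrderedBratteliDiagram) (d : ℕ) (lab : ∀ n, B.V n → Fin d)
    (hproper : B.IsProper d lab) (q : ℕ → ℕ) (hToeplitz : B.IsToeplitz q)
    (I : Measure B.X → Set (Fin d)) (hclean : B.IsClean lab I)
    (μ : Measure B.X) [IsProbabilityMeasure μ] (hμ : Ergodic B.vershik μ)
    (a : ℤ) (b : ℕ) (hb : 0 < b) (hab : IsCoprime a (b : ℤ)) :
    (IsMeasurableEigenvalue B.vershik μ (Complex.exp (2 * Real.pi * Complex.I * (a / b))) ∧
      ¬ IsContinuousEigenvalue B.vershik (Complex.exp (2 * Real.pi * Complex.I * (a / b)))) ↔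
    ∃ ν : ℕ → ℕ, IsTelescoping ν ∧ ∃ p bb : ℕ, ∃ k : Fin d → Fin d → ℕ,
      (p < b ∧ ∀ n, 2 ≤ n → pSeq q (ν n) ≡ p [MOD b]) ∧
      (1 < bb ∧ bb ≤ d ∧ ∀ᶠ n in atTop, b / Nat.gcd b (pSeq q (ν n)) = bb) ∧
      ((∀ t₁ t₂, k t₁ t₂ < bb) ∧
        ∀ t₁ ∈ I μ, ∀ t₂ ∈ I μ, ∀ t₃ ∈ I μ,
          p * k t₁ t₃ ≡ p * k t₁ t₂ + p * k t₂ t₃ [MOD b] ∧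
          p * k t₁ t₁ ≡ 0 [MOD b] ∧
          (p * k t₁ t₂ : ℤ) ≡ -(p * k t₂ t₁ : ℤ) [ZMOD b]) ∧
      (∀ᵐ x ∂μ, ∀ᶠ n in atTop,
        lab (ν n) (B.tau (ν n) x) ∈ I μ ∧
        B.suffixCount (ν n) (ν (n + 1)) x ≡
          k (lab (ν n) (B.tau (ν n) x)) (lab (ν (n + 1)) (B.tau (ν (n + 1)) x)) [MOD bb]) := by
  have hl := isPrimitiveRoot_exp_of_isCoprime hb hab
  have hcont := OrderedBratteliDiagram.isContinuousEigenvalue_iff hproper.properlyOrdered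
    hToeplitz hb hl
  obtain ⟨δ, hδ, hI, -⟩ := hclean
  obtain ⟨hδI, hI0⟩ := hI μ inferInstance hμ
  constructor
  · rintro ⟨hev, hnc⟩
    rw [hcont, not_exists] at hnc
    exact OrderedBratteliDiagram.exists_telescoping_of_eigenvalue hproper hToeplitz hμ hδ hδI hI0
      hb hl hev hnc
  · rintro ⟨ν, hν, p, bb, k, ⟨-, hp⟩, ⟨hbb, hbd, hgcd⟩, ⟨-, hk⟩, hs⟩
    refine ⟨OrderedBratteliDiagram.isMeasurableEigenvalue_of_telescoping hproper hToeplitz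
      hμ.toMeasurePreserving hb hl hν.1 hp hbb hbd hgcd
      (fun t₁ h₁ t₂ h₂ t₃ h₃ => (hk t₁ h₁ t₂ h₂ t₃ h₃).1) hs, ?_⟩
    rw [hcont]
    rintro ⟨m, hm⟩
    -- If b divided p_m it would divide p at every later level, and b / gcd would be 1 instead of
    -- `bb`.
    obtain ⟨n, hn, hmn⟩ := (hgcd.and (eventually_ge_atTop m)).exists
    rw [← OrderedBratteliDiagram.pSeq_eq_segProd] at hm
    have hdvd := hm.trans
      (OrderedBratteliDiagram.pSeq_dvd_pSeq (q := q) (hmn.trans (hν.1.le_apply (x := n))))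
    rw [Nat.gcd_eq_left hdvd, Nat.div_self hb] at hn
    omega
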